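/- **Setting.** Let $\mathbb I=[0,1]^2\setminus\{(0,r):r>0\}$ with the lexicographic order (a complete linear order), and write $\hat r=(r,r)$. Let $\mathcal L$ be a first-order language with countably many predicate, function and constant symbols, with a distinguished binary predicate symbol $d$ and, for every function or predicate symbol $e$, a map $\delta_e:\mathbb N_{\ge1}\to\mathbb N_{\ge1}$ (modulus of uniform continuity). Formulas are built from atomic formulas and nullary connectives $\bar r$ ($r\in\mathbb Q\cap[0,1]$) with $\wedge,\to,\forall,\exists$. Put $\neg\varphi:=\varphi\to\bar1$, $\varphi\vee\psi:=((\varphi\to\psi)\to\psi)\wedge((\psi\to\varphi)\to\varphi)$, $\varphi\leftrightarrow\psi:=(\varphi\to\psi)\wedge(\psi\to\varphi)$. A theory is a set of sentences. A structure $\mathcal M$ is a nonempty set $M$ with functions $f^{\mathcal M}:M^n\to M$, elements $c^{\mathcal M}\in M$ and predicates $P^{\mathcal M}:M^n\to\mathbb I$. Truth values: $\bar r$ is $\hat r$; $\varphi\wedge\psi$ is the maximum; $\varphi\to\psi$ is $\hat0$ if $\varphi\ge\psi$ and is the value of $\psi$ otherwise; $\forall x$ is the supremum and $\exists x$ the infimum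 over the values of $x$ in $M$. $\mathcal M$ is a model of $T$ if every sentence of $T$ has value $\hat 0$. Let $d_{\max}(x,y)=\hat0$ if $x=y$ and $\max\{x,y\}$ otherwise; for tuples $d(\bar a,\bar b)=\max_i d(a_i,b_i)$ (equal to $\hat 0$ for empty tuples). An *ultrametric structure* is a structure $\mathcal M$ such that, for all $a,b,c\in M$: $d(a,a)=\hat0$, $d(a,b)=d(b,a)$, $d(a,b)\le\max\{d(a,c),d(b,c)\}$, and $d(a,b)=\hat0$ implies $a=b$; and, for all $n\ge1$, all function symbols $f$, predicate symbols $P$ and tuples $\bar a,\bar b$: $$d(\bar a,\bar b)<\widehat{1/\delta_f(n)}\ \Rightarrow\ d(f(\bar a),f(\bar b))\le\widehat{1/n},\qquad d(\bar a,\bar b)<\widehat{1/\delta_P(n)}\ \Rightarrow\ d_{\max}(P(\bar a),P(\bar b))\le\widehat{1/n}.$$ *Ultrametric logic* (UML) is the Hilbert calculus with rules modus ponens and generalization ($\varphi\,/\,\forall x\,\varphi$) and the following axioms. - Propositional: $(\varphi\to\psi)\to((\psi\to\chi)\to(\varphi\to\chi))$; $(\varphi\wedge\psi)\to\varphi$;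 $(\varphi\wedge\psi)\to(\psi\wedge\varphi)$; $\varphi\to(\varphi\wedge\varphi)$; $(\varphi\to(\psi\to\chi))\leftrightarrow((\varphi\wedge\psi)\to\chi)$; $((\varphi\to\psi)\to\chi)\to(((\psi\to\varphi)\to\chi)\to\chi)$; $\bar1\to\varphi$. - Quantifiers ($t$ substitutable for $x$ in $\varphi$, $x$ not free in $\psi$): $\forall x\varphi(x)\to\varphi(t)$; $\forall x(\psi\to\varphi)\to(\psi\to\forall x\varphi)$; $\forall x(\psi\vee\varphi)\to(\psi\vee\forall x\varphi)$; $\varphi(t)\to\exists x\varphi(x)$; $\forall x(\varphi\to\psi)\to(\exists x\varphi\to\psi)$. - Book-keeping: $(\bar r\wedge\bar s)\leftrightarrow\overline{\max\{r,s\}}$; $\bar r\to\bar s$ if $r\ge s$; $(\bar r\to\bar s)\leftrightarrow\bar s$ if $r<s$; $\neg\neg\bar r$ if $r<1$. - Similarity: $\forall x\,d(x,x)$; $\forall x\forall y(d(x,y)\to d(y,x))$; $\forall x\forall y\forall z((d(x,y)\wedge d(y,z))\to d(x,z))$. - Weak extensionality, for all $f$, $P$ and $n\ge1$, where $d(\bar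 x,\bar y)$ is $\bigwedge_i d(x_i,y_i)$: $\forall\bar x\forall\bar y\big((d(\bar x,\bar y)\to\overline{1/\delta_f(n)})\vee(\overline{1/n}\to d(f(\bar x),f(\bar y)))\big)$ and $\forall\bar x\forall\bar y\big((d(\bar x,\bar y)\to\overline{1/\delta_P(n)})\vee(\overline{1/n}\to(P(\bar x)\leftrightarrow P(\bar y)))\big)$. $T$ is *strongly consistent* in UML if it proves $\bar r$ for no rational $r\in(0,1]$, and *finitely satisfiable* if every finite subset of $T$ has an ultrametric model. **Corollary.** Every theory that is strongly consistent in UML has an ultrametric model. Every finitely satisfiable theory has an ultrametric model. -/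

import Mathlib

universe u v w w'

namespace UltrametricLogic

noncomputable section

/-! ### The set of truth values -/

/-- The set of truth values `[0,1]² \ {(0,r) : r > 0}`, ordered lexicographically. -/
def TruthValue : Type :=
  {p : ℝ ×ₗ ℝ // (ofLex p).1 ∈ Set.Icc (0 : ℝ) 1 ∧ (ofLex p).2 ∈ Set.Icc (0 : ℝ) 1 ∧
    ((ofLex p).1 = 0 → (ofLex p).2 = 0)}

namespace TruthValue

instance instLinearOrder : LinearOrder TruthValue :=
  inferInstanceAs (LinearOrder {p : ℝ ×ₗ ℝ // (ofLex p).1 ∈ Set.Icc (0 : ℝ) 1 ∧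
    (ofLex p).2 ∈ Set.Icc (0 : ℝ) 1 ∧ ((ofLex p).1 = 0 → (ofLex p).2 = 0)})

/-- The first coordinate. -/
def fst (x : TruthValue) : ℝ := (ofLex x.1).1

/-- The second coordinate. -/
def snd (x : TruthValue) : ℝ := (ofLex x.1).2

/-- The truth value with given coordinates. -/
def mk (a b : ℝ) (ha : a ∈ Set.Icc (0 : ℝ) 1) (hb : b ∈ Set.Icc (0 : ℝ) 1)
    (h : a = 0 → b = 0) : TruthValue :=
  ⟨toLex (a, b), ha, hb, h⟩

theorem le_def (x y : TruthValue) :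
    x ≤ y ↔ x.fst < y.fst ∨ (x.fst = y.fst ∧ x.snd ≤ y.snd) := by
  change x.1 ≤ y.1 ↔ _
  exact Prod.Lex.le_iff

theorem exists_isLUB (S : Set TruthValue) : ∃ x, IsLUB S x := by
  by_cases hS : S.Nonempty
  · have bd1 : BddAbove (fst '' S) := ⟨1, by rintro _ ⟨p, _, rfl⟩; exact p.2.1.2⟩
    have ne1 : (fst '' S).Nonempty := hS.image _
    have ub1 : ∀ p ∈ S, p.fst ≤ sSup (fst '' S) := fun p hp => le_csSup bd1 ⟨p, hp, rfl⟩
    have h1 : sSup (fst '' S) ∈ Set.Icc (0 : ℝ) 1 := by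
      obtain ⟨p, hp⟩ := hS
      refine ⟨le_trans p.2.1.1 (ub1 p hp), csSup_le ne1 ?_⟩
      rintro _ ⟨q, _, rfl⟩
      exact q.2.1.2
    by_cases hatt : ∃ p ∈ S, p.fst = sSup (fst '' S)
    · let S2 : Set ℝ := snd '' {p ∈ S | p.fst = sSup (fst '' S)}
      obtain ⟨p0, hp0, hp0e⟩ := hatt
      have ne2 : S2.Nonempty := ⟨p0.snd, p0, ⟨hp0, hp0e⟩, rfl⟩
      have bd2 : BddAbove S2 := ⟨1, by rintro _ ⟨p, _, rfl⟩; exact p.2.2.1.2⟩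
      have h2 : sSup S2 ∈ Set.Icc (0 : ℝ) 1 := by
        refine ⟨le_trans p0.2.2.1.1 (le_csSup bd2 ⟨p0, ⟨hp0, hp0e⟩, rfl⟩), csSup_le ne2 ?_⟩
        rintro _ ⟨q, _, rfl⟩
        exact q.2.2.1.2
      have h3 : sSup (fst '' S) = 0 → sSup S2 = 0 := by
        intro h0
        refine le_antisymm (csSup_le ne2 ?_) h2.1
        rintro _ ⟨q, ⟨_, hq⟩, rfl⟩
        exact le_of_eq (q.2.2.2 (hq.trans h0))
      refine ⟨mk _ _ h1 h2 h3, ?_, ?_⟩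
      · intro p hp
        rw [le_def]
        rcases lt_or_eq_of_le (ub1 p hp) with h | h
        · exact Or.inl h
        · exact Or.inr ⟨h, le_csSup bd2 ⟨p, ⟨hp, h⟩, rfl⟩⟩
      · intro y hy
        rw [le_def]
        have hle : sSup (fst '' S) ≤ y.fst := by
          rw [← hp0e]
          rcases (le_def _ _).1 (hy hp0) with h | h
          · exact h.le
          · exact h.1.le
        rcases lt_or_eq_of_le hle with h | h
        · exact Or.inl h
        · refine Or.inr ⟨h, csSup_le ne2 ?_⟩
          rintro _ ⟨q, ⟨hq, hqe⟩, rfl⟩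
          rcases (le_def _ _).1 (hy hq) with h' | h'
          · exact absurd (hqe.trans h) h'.ne
          · exact h'.2
    · refine ⟨mk _ 0 h1 ⟨le_rfl, zero_le_one⟩ (fun _ => rfl), ?_, ?_⟩
      · intro p hp
        rw [le_def]
        exact Or.inl (lt_of_le_of_ne (ub1 p hp) fun h => hatt ⟨p, hp, h⟩)
      · intro y hy
        rw [le_def]
        have hle : sSup (fst '' S) ≤ y.fst := by
          refine csSup_le ne1 ?_
          rintro _ ⟨q, hq, rfl⟩
          rcases (le_def _ _).1 (hy hq) with h | h
          · exact h.le
          · exact h.1.le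
        rcases lt_or_eq_of_le hle with h | h
        · exact Or.inl h
        · exact Or.inr ⟨h, y.2.2.1.1⟩
  · refine ⟨mk 0 0 ⟨le_rfl, zero_le_one⟩ ⟨le_rfl, zero_le_one⟩ fun _ => rfl, ?_, ?_⟩
    · intro p hp
      exact absurd ⟨p, hp⟩ hS
    · intro y _
      rw [le_def]
      rcases lt_or_eq_of_le y.2.1.1 with h | h
      · exact Or.inl h
      · exact Or.inr ⟨h, y.2.2.1.1⟩

/-- The truth values form a complete linear order: every subset has a supremum and an infimum. -/
instance instCompleteLinearOrder : CompleteLinearOrder TruthValue :=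
  letI : SupSet TruthValue := ⟨fun S => Classical.choose (exists_isLUB S)⟩
  letI := completeLatticeOfSup TruthValue fun S => Classical.choose_spec (exists_isLUB S)
  { LinearOrder.toBiheytingAlgebra TruthValue, this, instLinearOrder with }

end TruthValue

/-- The rational numbers `r ∈ [0,1]` that index the nullary connectives `r̄`. -/
abbrev RatConst : Type := Set.Icc (0 : ℚ) 1

/-- The truth value `r̂ = (r, r)`. -/
def hat (r : RatConst) : TruthValue :=
  TruthValue.mk (r : ℚ) (r : ℚ) ⟨by exact_mod_cast r.2.1, by exact_mod_cast r.2.2⟩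
    ⟨by exact_mod_cast r.2.1, by exact_mod_cast r.2.2⟩ id

/-- The rational number `1 / n` in `[0,1]`, for `n ≥ 1`. -/
def invConst (n : ℕ+) : RatConst :=
  ⟨((n : ℕ) : ℚ)⁻¹, by positivity, inv_le_one_of_one_le₀ (by exact_mod_cast (one_le : 1 ≤ n))⟩

/-- `dmax x y` is `0̂` if `x = y` and `max x y` otherwise. -/
def dmax (x y : TruthValue) : TruthValue := if x = y then hat 0 else max x y

/-- The truth function of implication (`0̂` is absolute truth). -/
def impVal (x y : TruthValue) : TruthValue := if y ≤ x then hat 0 else y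

/-! ### Syntax

Variables are de Bruijn indices: in `all φ` and `ex φ` the variable `0` of `φ` is bound, and the
variable `i + 1` of `φ` is the variable `i` of the quantified formula. Constant symbols are the
function symbols of arity `0`. -/

/-- Formulas of rational Gödel logic `RGL*` over a first-order language. -/
inductive Form (L : FirstOrder.Language.{u, v}) : Type (max u v)
  | const (r : RatConst) : Form L
  | rel {n : ℕ} (P : L.Relations n) (ts : Fin n → L.Term ℕ) : Form L
  | and (φ ψ : Form L) : Form L
  | imp (φ ψ : Form L) : Form L
  | all (φ : Form L) : Form L
  | ex (φ : Form L) : Form L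

namespace Form

variable {L : FirstOrder.Language.{u, v}}

/-- `¬φ := φ → 1̄` (`1̄` is absolute falsity). -/
def neg (φ : Form L) : Form L := imp φ (const 1)

/-- `φ ∨ ψ := ((φ → ψ) → ψ) ∧ ((ψ → φ) → φ)`. -/
def or (φ ψ : Form L) : Form L := and (imp (imp φ ψ) ψ) (imp (imp ψ φ) φ)

/-- `φ ↔ ψ := (φ → ψ) ∧ (ψ → φ)`. -/
def iff (φ ψ : Form L) : Form L := and (imp φ ψ) (imp ψ φ)

/-- Every free variable of the formula is smaller than `k`. -/
def FreeBelow : ℕ → Form L → Prop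
  | _, const _ => True
  | k, rel _ ts => ∀ i, ∀ x ∈ (ts i).varFinset, x < k
  | k, and φ ψ => FreeBelow k φ ∧ FreeBelow k ψ
  | k, imp φ ψ => FreeBelow k φ ∧ FreeBelow k ψ
  | k, all φ => FreeBelow (k + 1) φ
  | k, ex φ => FreeBelow (k + 1) φ

/-- The substitution used below a quantifier: the bound variable stays, the others are shifted. -/
def up (s : ℕ → L.Term ℕ) : ℕ → L.Term ℕ
  | 0 => FirstOrder.Language.Term.var 0
  | i + 1 => (s i).relabel Nat.succ

/-- Simultaneous (capture-avoiding) substitution of terms for the free variables. -/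
def subst : (ℕ → L.Term ℕ) → Form L → Form L
  | _, const r => const r
  | s, rel P ts => rel P fun i => (ts i).subst s
  | s, and φ ψ => and (subst s φ) (subst s ψ)
  | s, imp φ ψ => imp (subst s φ) (subst s ψ)
  | s, all φ => all (subst (up s) φ)
  | s, ex φ => ex (subst (up s) φ)

/-- The formula read below one more quantifier, in whose bound variable it is not free. -/
def shift (φ : Form L) : Form L := subst (fun i => FirstOrder.Language.Term.var (i + 1)) φ

/-- `φ(t)`: the matrix `φ` of a quantified formula, with `t` substituted for the bound variable. -/
def inst (t : L.Term ℕ) (φ : Form L) : Form L :=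
  subst (fun i => Nat.casesOn i t fun j => FirstOrder.Language.Term.var j) φ

/-- `alls k φ` is `φ` preceded by `k` universal quantifiers. -/
def alls : ℕ → Form L → Form L
  | 0, φ => φ
  | k + 1, φ => all (alls k φ)

/-- The conjunction of a list of formulas; the empty conjunction is `0̄`. -/
def conj : List (Form L) → Form L
  | [] => const 0
  | [φ] => φ
  | φ :: ψ :: l => and φ (conj (ψ :: l))

end Form

/-- Sentences: formulas without free variables. -/
def Sentence (L : FirstOrder.Language.{u, v}) : Type (max u v) := {φ : Form L // φ.FreeBelow 0}

/-- A theory is a set of sentences. -/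
abbrev Theory (L : FirstOrder.Language.{u, v}) : Type (max u v) := Set (Sentence L)

/-! ### Semantics of `RGL*` -/

/-- Structures with predicates valued in the set of truth values. -/
structure Struct (L : FirstOrder.Language.{u, v}) where
  carrier : Type w
  nonempty : Nonempty carrier
  fn : ∀ {n : ℕ}, L.Functions n → (Fin n → carrier) → carrier
  pred : ∀ {n : ℕ}, L.Relations n → (Fin n → carrier) → TruthValue

namespace Struct

variable {L : FirstOrder.Language.{u, v}} (M : Struct.{u, v, w} L)

/-- Interpretation of terms under an assignment. -/
def termVal (σ : ℕ → M.carrier) : L.Term ℕ → M.carrier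
  | .var i => σ i
  | .func f ts => M.fn f fun i => termVal σ (ts i)

/-- The assignment that gives the innermost bound variable the value `a`. -/
def push (a : M.carrier) (σ : ℕ → M.carrier) : ℕ → M.carrier
  | 0 => a
  | i + 1 => σ i

/-- Interpretation of formulas under an assignment. -/
def val : (ℕ → M.carrier) → Form L → TruthValue
  | _, .const r => hat r
  | σ, .rel P ts => M.pred P fun i => M.termVal σ (ts i)
  | σ, .and φ ψ => max (val σ φ) (val σ ψ)
  | σ, .imp φ ψ => impVal (val σ φ) (val σ ψ)
  | σ, .all φ => ⨆ a : M.carrier, val (M.push a σ) φ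
  | σ, .ex φ => ⨅ a : M.carrier, val (M.push a σ) φ

/-- `M` satisfies every sentence of `T`, that is, gives it the value `0̂`. -/
def Models (T : Theory L) : Prop := ∀ φ ∈ T, ∀ σ : ℕ → M.carrier, M.val σ φ.1 = hat 0

end Struct

/-! ### The axioms of `RGL*` -/

open Form in
/-- The axioms of `RGL*`: propositional Gödel logic, quantifiers, book-keeping. -/
inductive RGLAx {L : FirstOrder.Language.{u, v}} : Form L → Prop
  | g1 (φ ψ χ) : RGLAx (imp (imp φ ψ) (imp (imp ψ χ) (imp φ χ)))
  | g2 (φ ψ) : RGLAx (imp (and φ ψ) φ)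
  | g3 (φ ψ) : RGLAx (imp (and φ ψ) (and ψ φ))
  | g4 (φ) : RGLAx (imp φ (and φ φ))
  | g5 (φ ψ χ) : RGLAx (iff (imp φ (imp ψ χ)) (imp (and φ ψ) χ))
  | g6 (φ ψ χ) : RGLAx (imp (imp (imp φ ψ) χ) (imp (imp (imp ψ φ) χ) χ))
  | g7 (φ) : RGLAx (imp (const 1) φ)
  | all1 (φ) (t : L.Term ℕ) : RGLAx (imp (all φ) (inst t φ))
  | all2 (φ ψ) : RGLAx (imp (all (imp (shift ψ) φ)) (imp ψ (all φ)))
  | all3 (φ ψ) : RGLAx (imp (all (or (shift ψ) φ)) (or ψ (all φ)))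
  | ex1 (φ) (t : L.Term ℕ) : RGLAx (imp (inst t φ) (ex φ))
  | ex2 (φ ψ) : RGLAx (imp (all (imp φ (shift ψ))) (imp (ex φ) ψ))
  | rgl1 (r s : RatConst) : RGLAx (iff (and (const r) (const s)) (const (max r s)))
  | rgl2_ge (r s : RatConst) (h : s ≤ r) : RGLAx (imp (const r) (const s))
  | rgl2_lt (r s : RatConst) (h : r < s) :
      RGLAx (iff (imp (const r) (const s)) (const s))
  | rgl3 (r : RatConst) (h : r < 1) : RGLAx (neg (neg (const r)))

/-! ### Ultrametric logic -/

/-- A continuous ultrametric language: a first-order language with a distinguished binary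
predicate symbol `d` and a modulus of uniform continuity for every function and predicate
symbol. -/
structure UltrametricLanguage extends FirstOrder.Language.{u, v} where
  d : toLanguage.Relations 2
  modFn : ∀ {n : ℕ}, toLanguage.Functions n → ℕ+ → ℕ+
  modPred : ∀ {n : ℕ}, toLanguage.Relations n → ℕ+ → ℕ+

namespace UltrametricLanguage

variable (L : UltrametricLanguage.{u, v})

/-- The formula `d(s, t)`. -/
def dist (s t : L.Term ℕ) : Form L.toLanguage := Form.rel L.d ![s, t]

/-- The variable `x_i` of a tuple `x̄` of `n` variables. -/
def xs (n : ℕ) (i : Fin n) : L.Term ℕ := FirstOrder.Language.Term.var i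

/-- The variable `y_i` of a second, disjoint tuple `ȳ` of `n` variables. -/
def ys (n : ℕ) (i : Fin n) : L.Term ℕ := FirstOrder.Language.Term.var (n + i)

/-- The formula `d(x̄, ȳ)`, that is, `d(x_1, y_1) ∧ … ∧ d(x_n, y_n)`. -/
def distTuple (n : ℕ) : Form L.toLanguage :=
  Form.conj (List.ofFn fun i : Fin n => L.dist (L.xs n i) (L.ys n i))

open Form FirstOrder.Language.Term in
/-- The axioms of ultrametric logic UML: those of `RGL*`, the similarity axioms for `d`, and the
weak extensionality axioms. (For constant symbols the latter are instances of
reflexivity.) -/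
inductive UMLAx : Form L.toLanguage → Prop
  | rgl {φ} : RGLAx φ → UMLAx φ
  | s1 : UMLAx (all (L.dist (var 0) (var 0)))
  | s2 : UMLAx (all (all (imp (L.dist (var 1) (var 0)) (L.dist (var 0) (var 1)))))
  | s3 : UMLAx (all (all (all
      (imp (and (L.dist (var 2) (var 1)) (L.dist (var 1) (var 0))) (L.dist (var 2) (var 0))))))
  | we1 {k : ℕ} (f : L.Functions k) (n : ℕ+) : UMLAx (alls (k + k)
      (or (imp (L.distTuple k) (const (invConst (L.modFn f n))))
        (imp (const (invConst n)) (L.dist (func f (L.xs k)) (func f (L.ys k))))))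
  | we2 {k : ℕ} (P : L.Relations k) (n : ℕ+) : UMLAx (alls (k + k)
      (or (imp (L.distTuple k) (const (invConst (L.modPred P n))))
        (imp (const (invConst n)) (iff (rel P (L.xs k)) (rel P (L.ys k))))))

/-- Provability from a theory in UML; the rules are modus ponens and generalization. -/
inductive Provable (T : Theory L.toLanguage) : Form L.toLanguage → Prop
  | ax {φ} : L.UMLAx φ → Provable T φ
  | hyp (φ) : φ ∈ T → Provable T φ.1
  | mp {φ ψ} : Provable T (Form.imp φ ψ) → Provable T φ → Provable T ψ
  | gen {φ} : Provable T φ → Provable T (Form.all φ)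

/-- `T` is strongly consistent in UML: it proves `r̄` for no rational `r > 0`. -/
def StronglyConsistent (T : Theory L.toLanguage) : Prop :=
  ∀ r : RatConst, 0 < r → ¬ L.Provable T (Form.const r)

/-- The interpretation of `d` in a structure. -/
def dVal (M : Struct.{u, v, w} L.toLanguage) (a b : M.carrier) : TruthValue :=
  M.pred L.d ![a, b]

/-- The distance of tuples: the maximum of the distances of the coordinates (for the empty tuple,
the least truth value). -/
def dTuple (M : Struct.{u, v, w} L.toLanguage) {n : ℕ} (a b : Fin n → M.carrier) : TruthValue :=
  ⨆ i, L.dVal M (a i) (b i)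

/-- Ultrametric structures: `d` is an extended ultrametric, and functions and predicates are
uniformly continuous with the given moduli. -/
structure IsUltrametric (M : Struct.{u, v, w} L.toLanguage) : Prop where
  d_self : ∀ a, L.dVal M a a = hat 0
  d_comm : ∀ a b, L.dVal M a b = L.dVal M b a
  d_triangle : ∀ a b c, L.dVal M a b ≤ max (L.dVal M a c) (L.dVal M b c)
  eq_of_d_eq_zero : ∀ a b, L.dVal M a b = hat 0 → a = b
  fn_unif : ∀ {k : ℕ} (f : L.Functions k) (n : ℕ+) (a b : Fin k → M.carrier),
    L.dTuple M a b < hat (invConst (L.modFn f n)) →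
      L.dVal M (M.fn f a) (M.fn f b) ≤ hat (invConst n)
  pred_unif : ∀ {k : ℕ} (P : L.Relations k) (n : ℕ+) (a b : Fin k → M.carrier),
    L.dTuple M a b < hat (invConst (L.modPred P n)) →
      dmax (M.pred P a) (M.pred P b) ≤ hat (invConst n)

/-- `T` has an ultrametric model (with universe in `Type w`). -/
def Satisfiable (T : Theory L.toLanguage) : Prop :=
  ∃ M : Struct.{u, v, w} L.toLanguage, L.IsUltrametric M ∧ M.Models T

/-- Every finite subset of `T` has an ultrametric model (with universe in `Type w`). -/
def FinitelySatisfiable (T : Theory L.toLanguage) : Prop :=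
  ∀ S : Theory L.toLanguage, S ⊆ T → S.Finite → Satisfiable.{u, v, w} L S

end UltrametricLanguage

end

end UltrametricLogic

/-! The proof is a Henkin construction in which strict comparison of truth values is replaced by
rational approximation. Smaller values are truer, so `imp (all φ) (const q)` says that a supremum is
at least `q`, and `imp (const q) (ex φ)` that an infimum is at most `q`. Over a fresh variable one
may assume that a single instance comes within every rational margin of all such bounds
(`StrongCons.add_all_witness`, `StrongCons.add_ex_witness`): otherwise the axiom `∀(ψ ∨ φ) → (ψ ∨
∀φ)` would yield a positive constant. Alternating such steps with maximal extension gives a Henkin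
set `G` (`exists_isHenkin`).

Modulo `G` the formulas form a countable linear order containing a copy of the rationals of `[0,1]`.
An element is sent to a pair: its first coordinate is the real cut that it makes among the
constants, and its second coordinate comes from an embedding into `[0,1]` of the fibre of elements
with the same cut (`exists_truthValue_map`). Thanks to the approximate witnesses, the supremum of
the instances of a formula lies in the same fibre as one of the instances, so only suprema and
infima within a fibre have to be preserved. That is possible because a countable linear order embeds
suitably in `[0,1]`, with one point prescribed (`exists_embedding_unitInterval`); the prescribed
point is the constant `r`, which has to go to `(r, r)`. The fibre over `0` collapses to absolute
truth. This is harmless: it does not affect strong consistency, and implication is still computed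
correctly.

The terms then form a structure in which every provable formula is absolutely true
(`val_termStruct`). The similarity and weak extensionality axioms make it an ultrametric structure,
except that distinct points may have distance zero. Since only `0̂` lies below all `1/n`, distance
zero is a congruence, and the quotient is the required model.

For a finitely satisfiable theory, a derivation of a positive constant would use finitely many
hypotheses and contradict soundness in a model of these. -/

namespace UltrametricLogic

/-! ### Embedding countable linear orders in the unit interval -/

section Embedding

/-- A dense order without endpoints in which `F` embeds preserving suprema and infima. -/
def DenseHull (F : Type*) [LinearOrder F] : Type _ :=
  {p : F ×ₗ ℚ // (ofLex p).2 = 0 ∨ (0 < (ofLex p).2 ∧ ((∃ b, (ofLex p).1 ⋖ b) ∨ IsTop (ofLex p).1))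
    ∨ ((ofLex p).2 < 0 ∧ IsBot (ofLex p).1)}

namespace DenseHull

variable {F : Type*} [LinearOrder F]

noncomputable instance : LinearOrder (DenseHull F) :=
  inferInstanceAs (LinearOrder {_p : F ×ₗ ℚ // _})

/-- The embedding of the order in its dense hull. -/
def of (a : F) : DenseHull F := ⟨toLex (a, 0), Or.inl rfl⟩

theorem lt_def (x y : DenseHull F) : x < y ↔ (ofLex x.1).1 < (ofLex y.1).1 ∨
    ((ofLex x.1).1 = (ofLex y.1).1 ∧ (ofLex x.1).2 < (ofLex y.1).2) := by
  change x.1 < y.1 ↔ _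
  exact Prod.Lex.lt_iff

theorem of_strictMono : StrictMono (of : F → DenseHull F) := fun _ _ h =>
  (lt_def _ _).2 (Or.inl h)

instance [Countable F] : Countable (DenseHull F) :=
  inferInstanceAs (Countable {_p : F × ℚ // _})

instance [Nonempty F] : Nonempty (DenseHull F) := ‹Nonempty F›.map of

/-- Positive rationals are inserted exactly in the jumps of `F` and above its top, negative ones
only below its bottom. A jump is therefore filled from its lower end, and between points with the
same first coordinate the midpoint is available once it is kept off the wrong side of `0`. -/
instance : DenselyOrdered (DenseHull F) := by
  refine ⟨?_⟩
  rintro ⟨⟨a, p⟩, hp⟩ ⟨⟨b, q⟩, hq⟩ h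
  replace h : a < b ∨ a = b ∧ p < q := (lt_def _ _).1 h
  change p = 0 ∨ (0 < p ∧ ((∃ b, a ⋖ b) ∨ IsTop a)) ∨ (p < 0 ∧ IsBot a) at hp
  change q = 0 ∨ (0 < q ∧ ((∃ c, b ⋖ c) ∨ IsTop b)) ∨ (q < 0 ∧ IsBot b) at hq
  rcases h with h | ⟨rfl, h⟩
  · by_cases hc : ∃ c, a < c ∧ c < b
    · obtain ⟨c, h1, h2⟩ := hc
      exact ⟨of c, (lt_def _ _).2 (Or.inl h1), (lt_def _ _).2 (Or.inl h2)⟩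
    · have hcov : a ⋖ b := ⟨h, fun c h1 h2 => hc ⟨c, h1, h2⟩⟩
      refine ⟨⟨toLex (a, max p 0 + 1), Or.inr (Or.inl ⟨?_, Or.inl ⟨b, hcov⟩⟩)⟩,
        (lt_def _ _).2 (Or.inr ⟨rfl, ?_⟩), (lt_def _ _).2 (Or.inl h)⟩
      · change 0 < max p 0 + 1
        positivity
      · change p < max p 0 + 1
        linarith [le_max_left p 0]
  · by_cases h0 : 0 < q
    · have hq' : (∃ c, a ⋖ c) ∨ IsTop a := by
        rcases hq with hq | hq | hq
        · exact absurd hq h0.ne'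
        · exact hq.2
        · exact absurd hq.1 (not_lt.2 h0.le)
      have hm : max p 0 < q := max_lt h h0
      refine ⟨⟨toLex (a, (max p 0 + q) / 2), Or.inr (Or.inl ⟨?_, hq'⟩)⟩,
        (lt_def _ _).2 (Or.inr ⟨rfl, ?_⟩), (lt_def _ _).2 (Or.inr ⟨rfl, ?_⟩)⟩
      · change 0 < (max p 0 + q) / 2
        positivity
      · change p < (max p 0 + q) / 2
        linarith [le_max_left p 0]
      · change (max p 0 + q) / 2 < q
        linarith
    · have hp0 : p < 0 := h.trans_le (not_lt.1 h0)
      have hp' : IsBot a := by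
        rcases hp with hp | hp | hp
        · exact absurd hp hp0.ne
        · exact absurd hp.1 (not_lt.2 hp0.le)
        · exact hp.2
      have := not_lt.1 h0
      refine ⟨⟨toLex (a, (p + q) / 2), Or.inr (Or.inr ⟨?_, hp'⟩)⟩,
        (lt_def _ _).2 (Or.inr ⟨rfl, ?_⟩), (lt_def _ _).2 (Or.inr ⟨rfl, ?_⟩)⟩
      · change (p + q) / 2 < 0
        linarith
      · change p < (p + q) / 2
        linarith
      · change (p + q) / 2 < q
        linarith

instance : NoMaxOrder (DenseHull F) := by
  refine ⟨?_⟩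
  rintro ⟨⟨a, p⟩, hp⟩
  by_cases ha : IsTop a
  · refine ⟨⟨toLex (a, max p 0 + 1), Or.inr (Or.inl ⟨?_, Or.inr ha⟩)⟩,
      (lt_def _ _).2 (Or.inr ⟨rfl, ?_⟩)⟩
    · change 0 < max p 0 + 1
      positivity
    · change p < max p 0 + 1
      linarith [le_max_left p 0]
  · obtain ⟨b, hb⟩ : ∃ b, a < b := by simpa [IsTop] using ha
    exact ⟨of b, (lt_def _ _).2 (Or.inl hb)⟩

instance : NoMinOrder (DenseHull F) := by
  refine ⟨?_⟩
  rintro ⟨⟨a, p⟩, hp⟩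
  by_cases ha : IsBot a
  · refine ⟨⟨toLex (a, min p 0 - 1), Or.inr (Or.inr ⟨?_, ha⟩)⟩,
      (lt_def _ _).2 (Or.inr ⟨rfl, ?_⟩)⟩
    · change min p 0 - 1 < 0
      linarith [min_le_right p 0]
    · change min p 0 - 1 < p
      linarith [min_le_left p 0]
  · obtain ⟨b, hb⟩ : ∃ b, b < a := by simpa [IsBot] using ha
    exact ⟨of b, (lt_def _ _).2 (Or.inl hb)⟩

/-- Inserted points lie above their first coordinate, so they cannot undercut a supremum; the
exception is the points below the bottom of `F`. In that case `a` is the bottom and `S`, being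
nonempty, contains it. -/
theorem isLUB_of {S : Set F} {a : F} (hS : S.Nonempty) (h : IsLUB S a) :
    IsLUB (of '' S) (of a) := by
  refine ⟨of_strictMono.monotone.mem_upperBounds_image h.1, ?_⟩
  rintro ⟨⟨b, q⟩, hq⟩ hb
  by_contra hlt
  replace hlt : b < a ∨ b = a ∧ q < 0 := (lt_def _ _).1 (lt_of_not_ge hlt)
  rcases hlt with hlt | ⟨rfl, hlt⟩
  · obtain ⟨s, hs, hbs⟩ := (lt_isLUB_iff h).1 hlt
    exact absurd (hb ⟨s, hs, rfl⟩) (not_le.2 ((lt_def _ _).2 (Or.inl hbs)))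
  · have hbot : IsBot b := by
      rcases hq with hq | hq | hq
      · exact absurd hq hlt.ne
      · exact absurd hq.1 (not_lt.2 hlt.le)
      · exact hq.2
    obtain ⟨s, hs⟩ := hS
    have : s = b := le_antisymm (h.1 hs) (hbot s)
    subst this
    exact absurd (hb ⟨s, hs, rfl⟩) (not_le.2 ((lt_def _ _).2 (Or.inr ⟨rfl, hlt⟩)))

/-- A point inserted just above `a` could spoil the infimum, but it exists only if `a` has a cover
or is the top. In both cases the infimum is attained, so `a ∈ S`. -/
theorem isGLB_of {S : Set F} {a : F} (hS : S.Nonempty) (h : IsGLB S a) :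
    IsGLB (of '' S) (of a) := by
  refine ⟨of_strictMono.monotone.mem_lowerBounds_image h.1, ?_⟩
  rintro ⟨⟨b, q⟩, hq⟩ hb
  by_contra hlt
  replace hlt : a < b ∨ a = b ∧ 0 < q := (lt_def _ _).1 (lt_of_not_ge hlt)
  rcases hlt with hlt | ⟨rfl, hlt⟩
  · obtain ⟨s, hs, hbs⟩ := (isGLB_lt_iff h).1 hlt
    exact absurd (hb ⟨s, hs, rfl⟩) (not_le.2 ((lt_def _ _).2 (Or.inl hbs)))
  · have hmem : a ∈ S := by
      have hcov : (∃ c, a ⋖ c) ∨ IsTop a := by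
        rcases hq with hq | hq | hq
        · exact absurd hq hlt.ne'
        · exact hq.2
        · exact absurd hq.1 (not_lt.2 hlt.le)
      rcases hcov with ⟨c, hc⟩ | htop
      · obtain ⟨s, hs, hsc⟩ := (isGLB_lt_iff h).1 hc.1
        rcases (h.1 hs).lt_or_eq with h' | h'
        · exact absurd hsc (hc.2 h')
        · exact h' ▸ hs
      · obtain ⟨s, hs⟩ := hS
        exact le_antisymm (h.1 hs) (htop s) ▸ hs
    exact absurd (hb ⟨a, hmem, rfl⟩) (not_le.2 ((lt_def _ _).2 (Or.inr ⟨rfl, hlt⟩)))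

end DenseHull

/-- A strictly increasing continuous map into the unit interval, up to a given point. -/
noncomputable def squash (q x : ℝ) : ℝ :=
  if x ≤ 0 then q * (1 - x)⁻¹ else 1 - (1 - q) * (1 + x)⁻¹

theorem continuous_squash (q : ℝ) : Continuous (squash q) := by
  -- With `min` and `max` the two branches merge into one formula, since each fraction is constant
  -- on the half-line where the other one varies.
  have h : squash q = fun x => q * (1 - min x 0)⁻¹ + (1 - q) - (1 - q) * (1 + max x 0)⁻¹ := by
    funext x
    by_cases hx : x ≤ 0
    · simp [squash, hx]
    · have := (not_le.1 hx).le
      simp [squash, hx, this]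
  rw [h]
  refine Continuous.sub (Continuous.add (continuous_const.mul (Continuous.inv₀ (by fun_prop) ?_))
    continuous_const) (continuous_const.mul (Continuous.inv₀ (by fun_prop) ?_))
  · intro x
    have := min_le_right x 0
    linarith
  · intro x
    have := le_max_right x 0
    linarith

theorem squash_zero (q : ℝ) : squash q 0 = q := by simp [squash]

theorem squash_mem {q : ℝ} (hq : q ∈ Set.Icc (0 : ℝ) 1) (x : ℝ) :
    squash q x ∈ Set.Icc (0 : ℝ) 1 := by
  unfold squash
  split_ifs with hx
  · have h1 : (1 - x)⁻¹ ≤ 1 := inv_le_one_of_one_le₀ (by linarith)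
    have h0 : 0 ≤ (1 - x)⁻¹ := inv_nonneg.2 (by linarith)
    exact ⟨mul_nonneg hq.1 h0, mul_le_one₀ hq.2 h0 h1⟩
  · have h1 : (1 + x)⁻¹ ≤ 1 := inv_le_one_of_one_le₀ (by linarith)
    have h0 : 0 ≤ (1 + x)⁻¹ := inv_nonneg.2 (by linarith)
    have h2 := mul_le_one₀ (sub_le_self 1 hq.1) h0 h1
    have h3 : 0 ≤ (1 - q) * (1 + x)⁻¹ := mul_nonneg (sub_nonneg.2 hq.2) h0
    constructor <;> linarith

theorem squash_mono {q : ℝ} (hq : q ∈ Set.Icc (0 : ℝ) 1) : Monotone (squash q) := by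
  have h : squash q = fun x => q * (1 - min x 0)⁻¹ + (1 - q) - (1 - q) * (1 + max x 0)⁻¹ := by
    funext x
    by_cases hx : x ≤ 0
    · simp [squash, hx]
    · have := (not_le.1 hx).le
      simp [squash, hx, this]
  rw [h]
  intro x y hxy
  have a1 : (1 - min x 0)⁻¹ ≤ (1 - min y 0)⁻¹ :=
    inv_anti₀ (by linarith [min_le_right y 0]) (by linarith [min_le_min_right 0 hxy])
  have a2 : (1 + max y 0)⁻¹ ≤ (1 + max x 0)⁻¹ :=
    inv_anti₀ (by linarith [le_max_right x 0]) (by linarith [max_le_max_right 0 hxy])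
  have b1 := mul_le_mul_of_nonneg_left a1 hq.1
  have b2 := mul_le_mul_of_nonneg_left a2 (sub_nonneg.2 hq.2)
  simp only
  linarith

/-- For `q = 1` the map is constant on the positive half-line, which is why the argument must then
stay nonpositive. -/
theorem squash_strict {q x y : ℝ} (hq : 0 < q) (hxy : x < y) (h : y ≤ 0 ∨ q < 1) :
    squash q x < squash q y := by
  have key : ∀ a b, a < b → b ≤ 0 → squash q a < squash q b := by
    intro a b hab hb
    simp only [squash, hb, hab.le.trans hb, if_true]
    exact mul_lt_mul_of_pos_left (inv_strictAnti₀ (by linarith) (by linarith)) hq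
  rcases le_or_gt y 0 with hy | hy
  · exact key x y hxy hy
  · have hq' : q < 1 := h.resolve_left (not_le.2 hy)
    have key2 : ∀ a, 0 ≤ a → a < y → squash q a < squash q y := by
      intro a ha hay
      have hinv : (1 + y)⁻¹ < (1 + a)⁻¹ := inv_strictAnti₀ (by linarith) (by linarith)
      have := mul_lt_mul_of_pos_left hinv (sub_pos.2 hq')
      rcases ha.eq_or_lt with rfl | ha
      · rw [squash_zero]
        simp only [squash, not_le.2 hy, if_false]
        simp at this
        linarith
      · simp only [squash, not_le.2 hy, not_le.2 ha, if_false]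
        linarith
    rcases lt_or_ge x 0 with hx | hx
    · exact (key x 0 hx le_rfl).trans (key2 0 le_rfl hy)
    · exact key2 x hx hxy

/-- A countable linear order embeds in the unit interval with prescribed value at one point,
preserving all suprema and infima of nonempty sets. -/
theorem exists_embedding_unitInterval {F : Type*} [LinearOrder F] [Countable F] (a₀ : F) {q : ℝ}
    (hq0 : 0 < q) (hq1 : q ≤ 1) (htop : q = 1 → IsTop a₀) :
    ∃ g : F → ℝ, StrictMono g ∧ g a₀ = q ∧ (∀ a, g a ∈ Set.Icc (0 : ℝ) 1) ∧
      (∀ S : Set F, ∀ a, S.Nonempty → IsLUB S a → IsLUB (g '' S) (g a)) ∧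
      (∀ S : Set F, ∀ a, S.Nonempty → IsGLB S a → IsGLB (g '' S) (g a)) := by
  have : Nonempty F := ⟨a₀⟩
  -- Cantor's theorem: the hull is countable, dense and without endpoints. Suprema and infima then
  -- survive the passages from `F` to the hull, to `ℚ`, to `ℝ`, and through a continuous monotone
  -- map.
  obtain ⟨e⟩ := Order.iso_of_countable_dense (DenseHull F) ℚ
  let j : F → ℝ := fun a => ((e (DenseHull.of a) : ℚ) : ℝ)
  have hj : StrictMono j := fun a b h =>
    Rat.cast_lt.2 (e.strictMono (DenseHull.of_strictMono h))
  have castLUB : ∀ (S : Set ℚ) (a : ℚ), IsLUB S a → IsLUB ((fun x : ℚ => (x : ℝ)) '' S) a := by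
    intro S a h
    refine ⟨(Rat.cast_strictMono (K := ℝ)).monotone.mem_upperBounds_image h.1, fun y hy => ?_⟩
    by_contra hlt
    obtain ⟨r, h1, h2⟩ := exists_rat_btwn (not_le.1 hlt)
    obtain ⟨s, hs, hrs⟩ := (lt_isLUB_iff h).1 (Rat.cast_lt.1 h2)
    have := hy ⟨s, hs, rfl⟩
    have h3 : (r : ℝ) < s := Rat.cast_lt.2 hrs
    exact absurd (h1.trans h3) (not_lt.2 this)
  have castGLB : ∀ (S : Set ℚ) (a : ℚ), IsGLB S a → IsGLB ((fun x : ℚ => (x : ℝ)) '' S) a := by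
    intro S a h
    refine ⟨(Rat.cast_strictMono (K := ℝ)).monotone.mem_lowerBounds_image h.1, fun y hy => ?_⟩
    by_contra hlt
    obtain ⟨r, h1, h2⟩ := exists_rat_btwn (not_le.1 hlt)
    obtain ⟨s, hs, hrs⟩ := (isGLB_lt_iff h).1 (Rat.cast_lt.1 h1)
    have := hy ⟨s, hs, rfl⟩
    have h3 : (s : ℝ) < r := Rat.cast_lt.2 hrs
    exact absurd (h3.trans h2) (not_lt.2 this)
  have himg : ∀ S : Set F, j '' S = (fun x : ℚ => (x : ℝ)) '' (e '' (DenseHull.of '' S)) := by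
    intro S
    simp only [Set.image_image, j]
  have hq : q ∈ Set.Icc (0 : ℝ) 1 := ⟨hq0.le, hq1⟩
  let σ : ℝ → ℝ := fun x => squash q (x - j a₀)
  have hσc : Continuous σ := (continuous_squash q).comp (by fun_prop)
  have hσm : Monotone σ := fun x y h => squash_mono hq (sub_le_sub_right h _)
  refine ⟨fun a => σ (j a), ?_, ?_, fun a => squash_mem hq _, ?_, ?_⟩
  · intro a b hab
    refine squash_strict hq0 (sub_lt_sub_right (hj hab) _) ?_
    rcases hq1.lt_or_eq with h | h
    · exact Or.inr h
    · exact Or.inl (sub_nonpos.2 (hj.monotone (htop h b)))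
  · change squash q (j a₀ - j a₀) = q
    rw [sub_self, squash_zero]
  · intro S a hS h
    have h1 : IsLUB (j '' S) (j a) := by
      rw [himg]
      exact castLUB _ _ ((e.isLUB_image').2 (DenseHull.isLUB_of hS h))
    have h2 := h1.isLUB_of_tendsto (fun x _ y _ h => hσm h) (hS.image _)
      (hσc.continuousAt.tendsto.mono_left nhdsWithin_le_nhds)
    rwa [Set.image_image] at h2
  · intro S a hS h
    have h1 : IsGLB (j '' S) (j a) := by
      rw [himg]
      exact castGLB _ _ ((e.isGLB_image').2 (DenseHull.isGLB_of hS h))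
    have h2 := h1.isGLB_of_tendsto (fun x _ y _ h => hσm h) (hS.image _)
      (hσc.continuousAt.tendsto.mono_left nhdsWithin_le_nhds)
    rwa [Set.image_image] at h2

end Embedding

/-! ### From a linear order with rational constants to truth values -/

section TruthValueMap

theorem TruthValue.ext' {x y : TruthValue} (h1 : x.fst = y.fst) (h2 : x.snd = y.snd) : x = y :=
  le_antisymm ((le_def _ _).2 (Or.inr ⟨h1, h2.le⟩)) ((le_def _ _).2 (Or.inr ⟨h1.symm, h2.ge⟩))

theorem TruthValue.fst_mono {x y : TruthValue} (h : x ≤ y) : x.fst ≤ y.fst := by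
  rcases (le_def _ _).1 h with h | h
  · exact h.le
  · exact h.1.le

theorem hat_fst (r : RatConst) : (hat r).fst = ((r : ℚ) : ℝ) := rfl

theorem hat_snd (r : RatConst) : (hat r).snd = ((r : ℚ) : ℝ) := rfl

theorem eq_hat_zero {x : TruthValue} (h : x.fst = 0) : x = hat 0 :=
  TruthValue.ext' (by rw [h, hat_fst]; simp) (by
    have h2 : x.snd = 0 := x.2.2.2 h
    rw [h2, hat_snd]; simp)

theorem exists_ratConst_btwn {x y : ℝ} (hx : 0 ≤ x) (hxy : x < y) (hy : y ≤ 1) :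
    ∃ r : RatConst, x < ((r : ℚ) : ℝ) ∧ ((r : ℚ) : ℝ) < y := by
  obtain ⟨r, h1, h2⟩ := exists_rat_btwn hxy
  exact ⟨⟨r, by exact_mod_cast (hx.trans h1.le), by exact_mod_cast (h2.le.trans hy)⟩, h1, h2⟩

variable {A : Type*} [LinearOrder A] (c : RatConst → A)

/-- The supremum of the rational numbers whose constants are below an element. -/
noncomputable def cut (a : A) : ℝ := sSup {x | ∃ r : RatConst, ((r : ℚ) : ℝ) = x ∧ c r ≤ a}

theorem cut_bddAbove (a : A) : BddAbove {x | ∃ r : RatConst, ((r : ℚ) : ℝ) = x ∧ c r ≤ a} :=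
  ⟨1, by rintro _ ⟨r, rfl, _⟩; exact_mod_cast r.2.2⟩

theorem le_cut {a : A} {r : RatConst} (h : c r ≤ a) : ((r : ℚ) : ℝ) ≤ cut c a :=
  le_csSup (cut_bddAbove c a) ⟨r, rfl, h⟩

/-- The set may be empty, because `c 0` is not assumed to be the least element. An element below all
constants gets the default supremum `0`, which is the intended value. -/
theorem cut_nonneg (a : A) : 0 ≤ cut c a :=
  Real.sSup_nonneg (by rintro _ ⟨r, rfl, _⟩; exact_mod_cast r.2.1)

theorem cut_le_one (a : A) : cut c a ≤ 1 :=
  Real.sSup_le (by rintro _ ⟨r, rfl, _⟩; exact_mod_cast r.2.2) zero_le_one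

theorem cut_mono : Monotone (cut c) := fun a b hab =>
  Real.sSup_le (by rintro _ ⟨r, rfl, h⟩; exact le_cut c (h.trans hab)) (cut_nonneg c b)

theorem exists_of_lt_cut {a : A} {x : ℝ} (hx : 0 ≤ x) (h : x < cut c a) :
    ∃ r : RatConst, x < ((r : ℚ) : ℝ) ∧ c r ≤ a := by
  have hne : {x | ∃ r : RatConst, ((r : ℚ) : ℝ) = x ∧ c r ≤ a}.Nonempty := by
    by_contra hne
    rw [Set.not_nonempty_iff_eq_empty] at hne
    rw [cut, hne, Real.sSup_empty] at h
    exact absurd h (not_lt.2 hx)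
  obtain ⟨_, ⟨r, rfl, hr⟩, h'⟩ := exists_lt_of_lt_csSup hne h
  exact ⟨r, h', hr⟩

variable {c}

theorem cut_const (hc : StrictMono c) (r : RatConst) : cut c (c r) = ((r : ℚ) : ℝ) := by
  refine le_antisymm (Real.sSup_le ?_ (by exact_mod_cast r.2.1)) (le_cut c le_rfl)
  rintro _ ⟨s, rfl, h⟩
  exact_mod_cast hc.le_iff_le.1 h

/-- A member of `S` that approximates the supremum within every rational margin makes the same cut:
a rational strictly between the two cuts could be enlarged to some `r'` with `c r' ≤ a`, and the
margin would then put `c r` below `s`. -/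
theorem cut_eq_of_isLUB {S : Set A} {a s : A} (ha : IsLUB S a) (hs : s ∈ S)
    (h : ∀ r r', r < r' → c r' ≤ a → c r ≤ s) : cut c s = cut c a := by
  refine le_antisymm (cut_mono c (ha.1 hs)) (le_of_not_gt fun hlt => ?_)
  obtain ⟨r, h1, h2⟩ := exists_ratConst_btwn (cut_nonneg c s) hlt (cut_le_one c a)
  obtain ⟨r', h3, h4⟩ := exists_of_lt_cut c ((cut_nonneg c s).trans h1.le) h2
  have hrr : r < r' := by exact_mod_cast h3
  exact absurd (le_cut c (h r r' hrr h4)) (not_le.2 h1)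

theorem cut_eq_of_isGLB {S : Set A} {a s : A} (hc : StrictMono c) (ha : IsGLB S a) (hs : s ∈ S)
    (h : ∀ r r', r < r' → a ≤ c r → s ≤ c r') : cut c s = cut c a := by
  refine le_antisymm (le_of_not_gt fun hlt => ?_) (cut_mono c (ha.1 hs))
  obtain ⟨r, h1, h2⟩ := exists_ratConst_btwn (cut_nonneg c a) hlt (cut_le_one c s)
  have hlt' : a < c r := lt_of_not_ge fun h' => absurd (le_cut c h') (not_le.2 h1)
  obtain ⟨r', h3, h4⟩ := exists_ratConst_btwn (by exact_mod_cast r.2.1) h2 (cut_le_one c s)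
  have := cut_mono c (h r r' (by exact_mod_cast h3) hlt'.le)
  rw [cut_const hc] at this
  exact absurd h4 (not_lt.2 this)

/-- By `cut_const` the fibre over `x` contains at most one constant, namely `c r` with `r = x`, and
this is the point whose value is prescribed. The map is total, and exists for every `x`, so that a
choice of maps can be made uniformly. -/
theorem exists_fibre_map [Countable A] (hc : StrictMono c) (htop : IsTop (c 1)) (x : ℝ) :
    ∃ g : A → ℝ, 0 < x →
      (∀ a b, cut c a = x → cut c b = x → a < b → g a < g b) ∧
      (∀ r : RatConst, ((r : ℚ) : ℝ) = x → g (c r) = x) ∧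
      (∀ a, g a ∈ Set.Icc (0 : ℝ) 1) ∧
      (∀ S : Set A, ∀ a, S.Nonempty → (∀ s ∈ S, cut c s = x) → cut c a = x → IsLUB S a →
        IsLUB (g '' S) (g a)) ∧
      (∀ S : Set A, ∀ a, S.Nonempty → (∀ s ∈ S, cut c s = x) → cut c a = x → IsGLB S a →
        IsGLB (g '' S) (g a)) := by
  classical
  by_cases hx : 0 < x ∧ ∃ a, cut c a = x
  swap
  · refine ⟨fun _ => 0, fun h => ?_⟩
    have hne : ∀ a, cut c a ≠ x := fun a ha => hx ⟨h, a, ha⟩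
    refine ⟨fun a b ha => absurd ha (hne a), ?_, by simp, fun S a _ _ ha => absurd ha (hne a),
      fun S a _ _ ha => absurd ha (hne a)⟩
    intro r hr
    exact absurd ((cut_const hc r).trans hr) (hne _)
  obtain ⟨hx, a₁, ha₁⟩ := hx
  let F := {a : A // cut c a = x}
  have hx1 : x ≤ 1 := ha₁ ▸ cut_le_one c a₁
  -- If the fibre contains no constant, any of its elements may be marked.
  obtain ⟨a₀, ha₀, hmark⟩ : ∃ a₀ : A, cut c a₀ = x ∧
      ∀ r : RatConst, ((r : ℚ) : ℝ) = x → c r = a₀ := by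
    by_cases hr : ∃ r : RatConst, ((r : ℚ) : ℝ) = x
    · obtain ⟨r, hr⟩ := hr
      refine ⟨c r, (cut_const hc r).trans hr, fun s hs => ?_⟩
      have : s = r := by
        apply Subtype.ext
        exact_mod_cast hs.trans hr.symm
      rw [this]
    · exact ⟨a₁, ha₁, fun r h => absurd ⟨r, h⟩ hr⟩
  obtain ⟨g, g1, g2, g3, g4, g5⟩ := exists_embedding_unitInterval (F := F) ⟨a₀, ha₀⟩ hx hx1 (by
    -- Over `x = 1` the marked point is `c 1`, the top of the whole order.
    rintro rfl ⟨b, hb⟩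
    have : c 1 = a₀ := hmark 1 (by simp)
    exact Subtype.mk_le_mk.2 (this ▸ htop b))
  let G : A → ℝ := fun a => if h : cut c a = x then g ⟨a, h⟩ else 0
  have hG : ∀ (a : A) (h : cut c a = x), G a = g ⟨a, h⟩ := fun a h => dif_pos h
  have himg : ∀ S : Set A, (∀ s ∈ S, cut c s = x) →
      G '' S = g '' ((fun p : F => p.1) ⁻¹' S) := by
    intro S hS
    ext y
    constructor
    · rintro ⟨s, hs, rfl⟩
      exact ⟨⟨s, hS s hs⟩, hs, (hG s _).symm⟩
    · rintro ⟨p, hp, rfl⟩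
      exact ⟨p.1, hp, hG p.1 p.2⟩
  refine ⟨G, fun _ => ⟨?_, ?_, ?_, ?_, ?_⟩⟩
  · intro a b ha hb hab
    rw [hG a ha, hG b hb]
    exact g1 (Subtype.mk_lt_mk.2 hab)
  · intro r hr
    rw [hmark r hr, hG a₀ ha₀, g2]
  · intro a
    by_cases h : cut c a = x
    · rw [hG a h]
      exact g3 _
    · simp [G, h]
  · intro S a hne hS ha h
    rw [himg S hS, hG a ha]
    refine g4 _ _ ?_ ⟨fun p hp => Subtype.mk_le_mk.2 (h.1 hp), ?_⟩
    · obtain ⟨s, hs⟩ := hne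
      exact ⟨⟨s, hS s hs⟩, hs⟩
    · intro b hb
      exact Subtype.mk_le_mk.2 (h.2 fun s hs => Subtype.mk_le_mk.1 (hb (a := ⟨s, hS s hs⟩) hs))
  · intro S a hne hS ha h
    rw [himg S hS, hG a ha]
    refine g5 _ _ ?_ ⟨fun p hp => Subtype.mk_le_mk.2 (h.1 hp), ?_⟩
    · obtain ⟨s, hs⟩ := hne
      exact ⟨⟨s, hS s hs⟩, hs⟩
    · intro b hb
      exact Subtype.mk_le_mk.2 (h.2 fun s hs => Subtype.mk_le_mk.1 (hb (a := ⟨s, hS s hs⟩) hs))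

/-- A countable linear order with rational constants maps to the truth values, preserving the
constants and the suprema and infima that are attained up to rational approximation. The map is
strictly increasing, except that infinitesimal elements become absolutely true. -/
theorem exists_truthValue_map [Countable A] (hc : StrictMono c) (htop : IsTop (c 1)) :
    ∃ V : A → TruthValue, (∀ r, V (c r) = hat r) ∧ Monotone V ∧
      (∀ a, (∀ r, 0 < r → ¬ c r ≤ a) → V a = hat 0) ∧
      (∀ a b, a < b → V a < V b ∨ V b = hat 0) ∧
      (∀ S : Set A, ∀ a, IsLUB S a → (∃ s ∈ S, ∀ r r', r < r' → c r' ≤ a → c r ≤ s) →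
        IsLUB (V '' S) (V a)) ∧
      (∀ S : Set A, ∀ a, IsGLB S a → (∃ s ∈ S, ∀ r r', r < r' → a ≤ c r → s ≤ c r') →
        IsGLB (V '' S) (V a)) := by
  choose g hg using exists_fibre_map hc htop
  have hsnd : ∀ a, (if 0 < cut c a then g (cut c a) a else 0) ∈ Set.Icc (0 : ℝ) 1 := by
    intro a
    split_ifs with h
    · exact (hg _ h).2.2.1 a
    · simp
  let V : A → TruthValue := fun a =>
    TruthValue.mk (cut c a) (if 0 < cut c a then g (cut c a) a else 0)
      ⟨cut_nonneg c a, cut_le_one c a⟩ (hsnd a) fun h => if_neg (by rw [h]; exact lt_irrefl _)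
  have Vfst : ∀ a, (V a).fst = cut c a := fun a => rfl
  have Vsnd : ∀ a, 0 < cut c a → (V a).snd = g (cut c a) a := fun a h => if_pos h
  have Vzero : ∀ a, ¬ 0 < cut c a → V a = hat 0 := fun a h =>
    eq_hat_zero (le_antisymm (not_lt.1 h) (cut_nonneg c a))
  have Vlt : ∀ a b, a < b → V a < V b ∨ V b = hat 0 := by
    intro a b hab
    by_cases h0 : 0 < cut c b
    · left
      refine lt_of_not_ge fun hle => ?_
      rcases (TruthValue.le_def _ _).1 hle with h | ⟨h, h'⟩
      · exact absurd (cut_mono c hab.le) (not_le.2 h)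
      · rw [Vfst, Vfst] at h
        have h0' : 0 < cut c a := h ▸ h0
        rw [Vsnd a h0', Vsnd b h0, ← h] at h'
        exact absurd ((hg _ h0).1 a b h.symm rfl hab) (not_lt.2 (h ▸ h'))
    · exact Or.inr (Vzero b h0)
  have Vmono : Monotone V := by
    intro a b hab
    rcases hab.eq_or_lt with rfl | hab
    · exact le_rfl
    · rcases Vlt a b hab with h | h
      · exact h.le
      · refine ((Vzero a ?_).trans h.symm).le
        have : cut c b = 0 := by rw [← Vfst, h, hat_fst]; simp
        rw [← this]
        exact not_lt.2 (cut_mono c hab.le)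
  refine ⟨V, ?_, Vmono, ?_, Vlt, ?_, ?_⟩
  · intro r
    have h1 := cut_const hc r
    by_cases h0 : 0 < cut c (c r)
    · refine TruthValue.ext' h1 ?_
      rw [Vsnd _ h0, (hg _ h0).2.1 r h1.symm, h1, hat_snd]
    · rw [Vzero _ h0]
      have : ((r : ℚ) : ℝ) = 0 := h1 ▸ le_antisymm (not_lt.1 h0) (cut_nonneg c _)
      exact (eq_hat_zero (by rw [hat_fst, this])).symm
  · intro a ha
    refine Vzero a fun h => ?_
    obtain ⟨r, hr, hra⟩ := exists_of_lt_cut c le_rfl h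
    exact ha r (by exact_mod_cast hr) hra
  · rintro S a ha ⟨s₀, hs₀, hcut⟩
    -- This excludes a supremum approached only from smaller cuts: the supremum of the image would
    -- then have second coordinate `0`, whatever `V a` is.
    have heq := cut_eq_of_isLUB ha hs₀ hcut
    refine ⟨Vmono.mem_upperBounds_image ha.1, fun y hy => ?_⟩
    have hy₀ : V s₀ ≤ y := hy ⟨s₀, hs₀, rfl⟩
    by_cases h0 : 0 < cut c a
    · have hle : cut c a ≤ y.fst := heq ▸ TruthValue.fst_mono hy₀
      rcases hle.lt_or_eq with hlt | hfst
      · exact (TruthValue.le_def _ _).2 (Or.inl hlt)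
      -- The members above the witness have the same supremum and lie in the fibre of `a`, where `g`
      -- preserves it.
      · let S' := S ∩ Set.Ici s₀
        have hS' : ∀ s ∈ S', cut c s = cut c a := fun s hs =>
          le_antisymm (cut_mono c (ha.1 hs.1)) (heq ▸ cut_mono c hs.2)
        have hlub : IsLUB S' a := by
          refine ⟨fun s hs => ha.1 hs.1, fun b hb => ha.2 fun s hs => ?_⟩
          rcases le_total s₀ s with h | h
          · exact hb ⟨hs, h⟩
          · exact h.trans (hb ⟨hs₀, le_rfl⟩)
        have key := (hg _ h0).2.2.2.1 S' a ⟨s₀, hs₀, le_rfl⟩ hS' rfl hlub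
        refine (TruthValue.le_def _ _).2 (Or.inr ⟨hfst, ?_⟩)
        rw [Vsnd a h0]
        refine key.2 ?_
        rintro _ ⟨s, hs, rfl⟩
        have hs' := hS' s hs
        rcases (TruthValue.le_def _ _).1 (hy ⟨s, hs.1, rfl⟩) with h | h
        · rw [Vfst, hs', hfst] at h
          exact absurd h (lt_irrefl _)
        · rw [← hs', ← Vsnd s (hs'.symm ▸ h0)]
          exact h.2
    · rw [Vzero a h0]
      rwa [Vzero s₀ (heq.symm ▸ h0)] at hy₀
  · rintro S a ha ⟨s₀, hs₀, hcut⟩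
    have heq := cut_eq_of_isGLB hc ha hs₀ hcut
    refine ⟨Vmono.mem_lowerBounds_image ha.1, fun y hy => ?_⟩
    have hy₀ : y ≤ V s₀ := hy ⟨s₀, hs₀, rfl⟩
    by_cases h0 : 0 < cut c a
    · have hle : y.fst ≤ cut c a := heq ▸ TruthValue.fst_mono hy₀
      rcases hle.lt_or_eq with hlt | hfst
      · exact (TruthValue.le_def _ _).2 (Or.inl hlt)
      · let S' := S ∩ Set.Iic s₀
        have hS' : ∀ s ∈ S', cut c s = cut c a := fun s hs =>
          le_antisymm (heq ▸ cut_mono c hs.2) (cut_mono c (ha.1 hs.1))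
        have hglb : IsGLB S' a := by
          refine ⟨fun s hs => ha.1 hs.1, fun b hb => ha.2 fun s hs => ?_⟩
          rcases le_total s s₀ with h | h
          · exact hb ⟨hs, h⟩
          · exact (hb ⟨hs₀, le_rfl⟩).trans h
        have key := (hg _ h0).2.2.2.2 S' a ⟨s₀, hs₀, le_rfl⟩ hS' rfl hglb
        refine (TruthValue.le_def _ _).2 (Or.inr ⟨hfst, ?_⟩)
        rw [Vsnd a h0]
        refine key.2 ?_
        rintro _ ⟨s, hs, rfl⟩
        have hs' := hS' s hs
        rcases (TruthValue.le_def _ _).1 (hy ⟨s, hs.1, rfl⟩) with h | h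
        · rw [Vfst, hs', hfst] at h
          exact absurd h (lt_irrefl _)
        · rw [← hs', ← Vsnd s (hs'.symm ▸ h0)]
          exact h.2
    · rw [Vzero a h0, ← Vzero s₀ (heq.symm ▸ h0)]
      exact hy₀

end TruthValueMap

open FirstOrder.Language

/-! ### Substitution calculus for de Bruijn formulas, and countability -/

section Substitution

variable {L : FirstOrder.Language.{u, v}}

theorem term_subst_relabel {α β γ : Type*} (t : L.Term α) (g : α → β) (s : β → L.Term γ) :
    (t.relabel g).subst s = t.subst (s ∘ g) := by
  induction t with
  | var => rfl
  | func f ts ih => simp [Term.subst, ih]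

theorem term_relabel_subst {α β γ : Type*} (t : L.Term α) (s : α → L.Term β) (g : β → γ) :
    (t.subst s).relabel g = t.subst fun i => (s i).relabel g := by
  induction t with
  | var => rfl
  | func f ts ih => simp [Term.subst, ih]

theorem term_subst_subst {α β γ : Type*} (t : L.Term α) (r : α → L.Term β) (s : β → L.Term γ) :
    (t.subst r).subst s = t.subst fun i => (r i).subst s := by
  induction t with
  | var => rfl
  | func f ts ih => simp [Term.subst, ih]

theorem term_subst_var {α : Type*} (t : L.Term α) : t.subst Term.var = t := by
  induction t with
  | var => rfl
  | func f ts ih => simp [Term.subst, ih]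

theorem term_subst_congr (t : L.Term ℕ) (r s : ℕ → L.Term ℕ)
    (h : ∀ x ∈ t.varFinset, r x = s x) : t.subst r = t.subst s := by
  induction t with
  | var i => exact h i (by simp)
  | func f ts ih =>
    simp only [Term.subst, Term.func.injEq, heq_eq_eq, true_and]
    funext i
    refine ih i fun x hx => h x ?_
    simp only [Term.varFinset, Finset.mem_biUnion, Finset.mem_univ, true_and]
    exact ⟨i, hx⟩

theorem term_subst_varFinset {N M : ℕ} (t : L.Term ℕ) (s : ℕ → L.Term ℕ)
    (ht : ∀ x ∈ t.varFinset, x < N) (hs : ∀ i < N, ∀ x ∈ (s i).varFinset, x < M) :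
    ∀ x ∈ (t.subst s).varFinset, x < M := by
  induction t with
  | var i => exact hs i (ht i (by simp))
  | func f ts ih =>
    intro x hx
    simp only [Term.subst, Term.varFinset, Finset.mem_biUnion, Finset.mem_univ, true_and] at hx
    obtain ⟨i, hi⟩ := hx
    refine ih i (fun y hy => ht y ?_) x hi
    simp only [Term.varFinset, Finset.mem_biUnion, Finset.mem_univ, true_and]
    exact ⟨i, hy⟩

namespace Form

theorem up_var : up (Term.var : ℕ → L.Term ℕ) = Term.var := by
  funext i
  cases i <;> rfl

theorem up_comp (r s : ℕ → L.Term ℕ) :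
    up (fun i => (r i).subst s) = fun i => (up r i).subst (up s) := by
  funext i
  cases i with
  | zero => rfl
  | succ i =>
    simp only [up, term_relabel_subst, term_subst_relabel]
    rfl

theorem subst_var (φ : Form L) : subst Term.var φ = φ := by
  induction φ with
  | const r => rfl
  | rel P ts => simp [subst, term_subst_var]
  | and φ ψ h1 h2 => simp [subst, h1, h2]
  | imp φ ψ h1 h2 => simp [subst, h1, h2]
  | all φ h => simp [subst, up_var, h]
  | ex φ h => simp [subst, up_var, h]

theorem subst_subst (φ : Form L) (r s : ℕ → L.Term ℕ) :
    subst s (subst r φ) = subst (fun i => (r i).subst s) φ := by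
  induction φ generalizing r s with
  | const r => rfl
  | rel P ts => simp [subst, term_subst_subst]
  | and φ ψ h1 h2 => simp [subst, h1, h2]
  | imp φ ψ h1 h2 => simp [subst, h1, h2]
  | all φ h => simp [subst, up_comp, h]
  | ex φ h => simp [subst, up_comp, h]

theorem up_congr {N : ℕ} {r s : ℕ → L.Term ℕ} (h : ∀ i < N, r i = s i) :
    ∀ i < N + 1, up r i = up s i := by
  intro i hi
  cases i with
  | zero => rfl
  | succ i => simp [up, h i (by omega)]

theorem subst_congr {N : ℕ} {φ : Form L} (hφ : φ.FreeBelow N) {r s : ℕ → L.Term ℕ}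
    (h : ∀ i < N, r i = s i) : subst r φ = subst s φ := by
  induction φ generalizing N r s with
  | const r => rfl
  | rel P ts =>
    simp only [subst, rel.injEq, heq_eq_eq, true_and]
    funext i
    exact term_subst_congr _ _ _ fun x hx => h x (hφ i x hx)
  | and φ ψ h1 h2 => simp [subst, h1 hφ.1 h, h2 hφ.2 h]
  | imp φ ψ h1 h2 => simp [subst, h1 hφ.1 h, h2 hφ.2 h]
  | all φ ih => simp [subst, ih hφ (up_congr h)]
  | ex φ ih => simp [subst, ih hφ (up_congr h)]

theorem subst_eq_self {φ : Form L} (hφ : φ.FreeBelow 0) (s : ℕ → L.Term ℕ) : subst s φ = φ := by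
  rw [subst_congr hφ (s := Term.var) (by simp), subst_var]

theorem FreeBelow.mono {N M : ℕ} {φ : Form L} (hφ : φ.FreeBelow N) (h : N ≤ M) :
    φ.FreeBelow M := by
  induction φ generalizing N M with
  | const r => trivial
  | rel P ts => exact fun i x hx => (hφ i x hx).trans_le h
  | and φ ψ h1 h2 => exact ⟨h1 hφ.1 h, h2 hφ.2 h⟩
  | imp φ ψ h1 h2 => exact ⟨h1 hφ.1 h, h2 hφ.2 h⟩
  | all φ ih => exact ih (N := N + 1) (M := M + 1) hφ (by omega)
  | ex φ ih => exact ih (N := N + 1) (M := M + 1) hφ (by omega)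

theorem exists_freeBelow (φ : Form L) : ∃ N, φ.FreeBelow N := by
  induction φ with
  | const r => exact ⟨0, trivial⟩
  | @rel n P ts =>
    refine ⟨(Finset.univ.biUnion fun i => (ts i).varFinset).sup id + 1, fun i x hx => ?_⟩
    refine Nat.lt_succ_of_le (Finset.le_sup (f := id) ?_)
    exact Finset.mem_biUnion.2 ⟨i, Finset.mem_univ _, hx⟩
  | and φ ψ h1 h2 =>
    obtain ⟨n, h1⟩ := h1
    obtain ⟨m, h2⟩ := h2
    exact ⟨max n m, h1.mono (le_max_left _ _), h2.mono (le_max_right _ _)⟩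
  | imp φ ψ h1 h2 =>
    obtain ⟨n, h1⟩ := h1
    obtain ⟨m, h2⟩ := h2
    exact ⟨max n m, h1.mono (le_max_left _ _), h2.mono (le_max_right _ _)⟩
  | all φ h =>
    obtain ⟨n, h⟩ := h
    exact ⟨n, FreeBelow.mono (M := n + 1) h (by omega)⟩
  | ex φ h =>
    obtain ⟨n, h⟩ := h
    exact ⟨n, FreeBelow.mono (M := n + 1) h (by omega)⟩

theorem up_freeBelow {N M : ℕ} {s : ℕ → L.Term ℕ}
    (hs : ∀ i < N, ∀ x ∈ (s i).varFinset, x < M) :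
    ∀ i < N + 1, ∀ x ∈ (up s i).varFinset, x < M + 1 := by
  intro i hi x hx
  cases i with
  | zero =>
    simp only [up, Term.varFinset, Finset.mem_singleton] at hx
    omega
  | succ i =>
    have h : (s i).relabel Nat.succ = (s i).subst fun j => Term.var (j + 1) := by
      generalize s i = t
      induction t with
      | var => rfl
      | func f ts ih => simp [Term.subst, ih]
    simp only [up, h] at hx
    refine term_subst_varFinset (N := M) (M := M + 1) _ _ (hs i (by omega)) ?_ x hx
    intro j hj y hy
    simp only [Term.varFinset, Finset.mem_singleton] at hy
    omega

theorem FreeBelow.subst {N M : ℕ} {φ : Form L} (hφ : φ.FreeBelow N) {s : ℕ → L.Term ℕ}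
    (hs : ∀ i < N, ∀ x ∈ (s i).varFinset, x < M) : (Form.subst s φ).FreeBelow M := by
  induction φ generalizing N M s with
  | const r => trivial
  | rel P ts => exact fun i => term_subst_varFinset _ _ (hφ i) hs
  | and φ ψ h1 h2 => exact ⟨h1 hφ.1 hs, h2 hφ.2 hs⟩
  | imp φ ψ h1 h2 => exact ⟨h1 hφ.1 hs, h2 hφ.2 hs⟩
  | all φ ih => exact ih (N := N + 1) (M := M + 1) hφ (up_freeBelow hs)
  | ex φ ih => exact ih (N := N + 1) (M := M + 1) hφ (up_freeBelow hs)

/-- The substitution that puts `t` for the variable `0` and lowers the others. -/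
def instSubst (t : L.Term ℕ) : ℕ → L.Term ℕ :=
  fun i => Nat.casesOn i t fun j => Term.var j

theorem inst_eq (t : L.Term ℕ) (φ : Form L) : inst t φ = subst (instSubst t) φ := rfl

theorem inst_shift (t : L.Term ℕ) (φ : Form L) : inst t (shift φ) = φ := by
  rw [inst_eq, shift, subst_subst]
  exact subst_var φ

/-- The two substitutions merge into one, which assigns `t` to the bound variable just as
`Struct.push` does; the quantifier cases of the truth lemma rest on this. -/
theorem inst_subst_up (t : L.Term ℕ) (s : ℕ → L.Term ℕ) (φ : Form L) :
    inst t (subst (up s) φ) = subst (fun i => Nat.casesOn i t s) φ := by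
  rw [inst_eq, subst_subst]
  congr 1
  funext i
  cases i with
  | zero => rfl
  | succ i =>
    simp only [up, term_subst_relabel]
    exact term_subst_var _

theorem inst_zero_shift (φ : Form L) :
    inst (Term.var 0) (subst (up fun i => Term.var (i + 1)) φ) = φ := by
  rw [inst_subst_up]
  refine Eq.trans ?_ (subst_var φ)
  congr 1
  funext i
  cases i <;> rfl

theorem subst_inst (s : ℕ → L.Term ℕ) (t : L.Term ℕ) (φ : Form L) :
    subst s (inst t φ) = inst (t.subst s) (subst (up s) φ) := by
  rw [inst_subst_up, inst_eq, subst_subst]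
  congr 1
  funext i
  cases i <;> rfl

theorem subst_up_shift (s : ℕ → L.Term ℕ) (φ : Form L) :
    subst (up s) (shift φ) = shift (subst s φ) := by
  rw [shift, shift, subst_subst, subst_subst]
  congr 1
  funext i
  change (s i).relabel Nat.succ = _
  generalize s i = t
  induction t with
  | var => rfl
  | func f ts ih => simp [Term.subst, ih]

theorem FreeBelow.inst_var {N : ℕ} {φ : Form L} (hφ : φ.FreeBelow (N + 1)) :
    (inst (Term.var N) φ).FreeBelow (N + 1) := by
  refine hφ.subst fun i hi x hx => ?_
  cases i with
  | zero =>
    have : x = N := by simpa using hx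
    omega
  | succ i =>
    have : x = i := by simpa using hx
    omega

/-- The substitution that makes the variable `N` the variable `0` and raises the others. -/
def rotate (N : ℕ) : ℕ → L.Term ℕ := fun i => if i = N then Term.var 0 else Term.var (i + 1)

theorem subst_rotate {N : ℕ} {φ : Form L} (hφ : φ.FreeBelow N) :
    subst (rotate N) φ = shift φ :=
  subst_congr hφ fun i hi => by simp [rotate, hi.ne]

/-- Together with `subst_rotate` this turns a fresh free variable `N` into a variable ready to be
bound, while hypotheses not containing `N` are merely shifted. -/
theorem subst_rotate_inst {N : ℕ} {φ : Form L} (hφ : φ.FreeBelow (N + 1)) :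
    subst (rotate N) (inst (Term.var N) φ) = φ := by
  rw [inst_eq, subst_subst, subst_congr hφ (s := Term.var), subst_var]
  intro i hi
  cases i with
  | zero => simp [instSubst, rotate, Term.subst]
  | succ i =>
    have : i ≠ N := by omega
    simp [instSubst, rotate, Term.subst, this]

theorem freeBelow_alls {N : ℕ} (k : ℕ) {φ : Form L} (h : φ.FreeBelow (N + k)) :
    (alls k φ).FreeBelow N := by
  induction k generalizing N with
  | zero => exact h
  | succ k ih => exact ih (N := N + 1) (h.mono (by omega))

theorem freeBelow_conj {N : ℕ} (l : List (Form L)) (h : ∀ φ ∈ l, φ.FreeBelow N) :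
    (conj l).FreeBelow N := by
  induction l with
  | nil => trivial
  | cons φ l ih =>
    cases l with
    | nil => exact h φ (by simp)
    | cons ψ l => exact ⟨h φ (by simp), ih fun χ hχ => h χ (by simp [hχ])⟩

/-- The formulas of bounded height. -/
def ofHeight : ℕ → Set (Form L)
  | 0 => Set.range const ∪ Set.range fun p : Σ n, L.Relations n × (Fin n → L.Term ℕ) =>
      rel p.2.1 p.2.2
  | n + 1 => ofHeight n ∪ Set.image2 and (ofHeight n) (ofHeight n) ∪
      Set.image2 imp (ofHeight n) (ofHeight n) ∪ all '' ofHeight n ∪ ex '' ofHeight n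

theorem ofHeight_mono : Monotone (ofHeight (L := L)) :=
  monotone_nat_of_le_succ fun _ _ h => Or.inl (Or.inl (Or.inl (Or.inl h)))

theorem exists_ofHeight (φ : Form L) : ∃ n, φ ∈ ofHeight n := by
  induction φ with
  | const r => exact ⟨0, Or.inl ⟨r, rfl⟩⟩
  | @rel n P ts => exact ⟨0, Or.inr ⟨⟨n, P, ts⟩, rfl⟩⟩
  | and φ ψ h1 h2 =>
    obtain ⟨n, h1⟩ := h1
    obtain ⟨m, h2⟩ := h2
    exact ⟨max n m + 1, Or.inl (Or.inl (Or.inl (Or.inr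
      ⟨φ, ofHeight_mono (le_max_left n m) h1, ψ, ofHeight_mono (le_max_right n m) h2, rfl⟩)))⟩
  | imp φ ψ h1 h2 =>
    obtain ⟨n, h1⟩ := h1
    obtain ⟨m, h2⟩ := h2
    exact ⟨max n m + 1, Or.inl (Or.inl (Or.inr
      ⟨φ, ofHeight_mono (le_max_left n m) h1, ψ, ofHeight_mono (le_max_right n m) h2, rfl⟩))⟩
  | all φ h =>
    obtain ⟨n, h⟩ := h
    exact ⟨n + 1, Or.inl (Or.inr ⟨φ, h, rfl⟩)⟩
  | ex φ h =>
    obtain ⟨n, h⟩ := h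
    exact ⟨n + 1, Or.inr ⟨φ, h, rfl⟩⟩

theorem countable_form [Countable L.Symbols] : Countable (Form L) := by
  have hr : Countable (Σ n, L.Relations n × (Fin n → L.Term ℕ)) := by
    have : Countable (Σ n, L.Relations n) :=
      Function.Injective.countable (f := fun p => (Sum.inr p : L.Symbols)) Sum.inr_injective
    have : ∀ n, Countable (L.Relations n) := fun n =>
      Function.Injective.countable (f := fun P => (⟨n, P⟩ : Σ n, L.Relations n)) sigma_mk_injective
    infer_instance
  have h : ∀ n, (ofHeight (L := L) n).Countable := by
    intro n
    induction n with
    | zero => exact (Set.countable_range _).union (Set.countable_range _)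
    | succ n ih =>
      exact (((ih.union (ih.image2 ih _)).union (ih.image2 ih _)).union (ih.image _)).union
        (ih.image _)
  rw [← Set.countable_univ_iff]
  refine (Set.countable_iUnion h).mono fun φ _ => ?_
  exact Set.mem_iUnion.2 (exists_ofHeight φ)

end Form

end Substitution

open Form

/-! ### Propositional derivations in Gödel logic -/

section PropositionalLogic

variable {L : FirstOrder.Language.{u, v}}

/-- A set of formulas that contains the axioms of `RGL*` and is closed under modus ponens. -/
structure IsDeductive (D : Form L → Prop) : Prop where
  ax : ∀ {φ}, RGLAx φ → D φ
  mp : ∀ {φ ψ}, D (imp φ ψ) → D φ → D ψ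

namespace IsDeductive

variable {D : Form L → Prop} (hD : IsDeductive D) {φ ψ χ θ : Form L}

include hD

theorem trans (h1 : D (imp φ ψ)) (h2 : D (imp ψ χ)) : D (imp φ χ) :=
  hD.mp (hD.mp (hD.ax (RGLAx.g1 φ ψ χ)) h1) h2

theorem and_left : D (imp (and φ ψ) φ) := hD.ax (RGLAx.g2 φ ψ)

theorem and_right : D (imp (and φ ψ) ψ) := hD.trans (hD.ax (RGLAx.g3 φ ψ)) hD.and_left

theorem iff_mp (h : D (iff φ ψ)) : D (imp φ ψ) := hD.mp hD.and_left h

theorem iff_mpr (h : D (iff φ ψ)) : D (imp ψ φ) := hD.mp hD.and_right h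

theorem refl : D (imp φ φ) := hD.trans (hD.ax (RGLAx.g4 φ)) hD.and_left

theorem curry (h : D (imp (and φ ψ) χ)) : D (imp φ (imp ψ χ)) :=
  hD.mp (hD.iff_mpr (hD.ax (RGLAx.g5 φ ψ χ))) h

theorem uncurry (h : D (imp φ (imp ψ χ))) : D (imp (and φ ψ) χ) :=
  hD.mp (hD.iff_mp (hD.ax (RGLAx.g5 φ ψ χ))) h

theorem weaken (h : D φ) : D (imp ψ φ) := hD.mp (hD.curry hD.and_left) h

theorem and_intro (h1 : D φ) (h2 : D ψ) : D (and φ ψ) :=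
  hD.mp (hD.mp (hD.curry hD.refl) h1) h2

theorem swap (h : D (imp φ (imp ψ χ))) : D (imp ψ (imp φ χ)) :=
  hD.curry (hD.trans (hD.ax (RGLAx.g3 ψ φ)) (hD.uncurry h))

theorem contract (h : D (imp φ (imp φ χ))) : D (imp φ χ) :=
  hD.trans (hD.ax (RGLAx.g4 φ)) (hD.uncurry h)

theorem imp_mp (h1 : D (imp φ (imp ψ χ))) (h2 : D (imp φ ψ)) : D (imp φ χ) :=
  hD.contract (hD.trans h2 (hD.swap h1))

theorem imp_and (h1 : D (imp θ φ)) (h2 : D (imp θ ψ)) : D (imp θ (and φ ψ)) :=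
  hD.imp_mp (hD.imp_mp (hD.weaken (hD.curry hD.refl)) h1) h2

theorem or_inl : D (imp φ (or φ ψ)) :=
  hD.imp_and (hD.swap hD.refl) (hD.curry hD.and_left)

theorem or_inr : D (imp ψ (or φ ψ)) :=
  hD.imp_and (hD.curry hD.and_left) (hD.swap hD.refl)

theorem linear (h1 : D (imp (imp φ ψ) χ)) (h2 : D (imp (imp ψ φ) χ)) : D χ :=
  hD.mp (hD.mp (hD.ax (RGLAx.g6 φ ψ χ)) h1) h2

/-- By prelinearity `χ` may be derived from `φ → ψ` and from `ψ → φ` separately; the two conjuncts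
of the defined disjunction turn these into `ψ` and `φ`. -/
theorem or_elim (h1 : D (imp φ χ)) (h2 : D (imp ψ χ)) (h : D (or φ ψ)) : D χ :=
  hD.linear (φ := φ) (ψ := ψ) (hD.trans (hD.mp hD.and_left h) h2)
    (hD.trans (hD.mp hD.and_right h) h1)

theorem imp_const_mono {r s : RatConst} (h : s ≤ r) (h1 : D (imp φ (const r))) :
    D (imp φ (const s)) :=
  hD.trans h1 (hD.ax (RGLAx.rgl2_ge r s h))

theorem const_of_imp {r s : RatConst} (h : r < s) (h1 : D (imp (const r) (const s))) :
    D (const s) :=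
  hD.mp (hD.iff_mp (hD.ax (RGLAx.rgl2_lt r s h))) h1

theorem imp_left (h : D (imp φ ψ)) : D (imp (imp ψ χ) (imp φ χ)) :=
  hD.mp (hD.ax (RGLAx.g1 φ ψ χ)) h

theorem imp_right (h : D (imp ψ χ)) : D (imp (imp φ ψ) (imp φ χ)) :=
  hD.mp (hD.swap (hD.ax (RGLAx.g1 φ ψ χ))) h

end IsDeductive

end PropositionalLogic

/-! ### Derivations from open hypotheses, the deduction theorem, witnesses -/

section Derivations

variable {L : UltrametricLanguage.{u, v}} {T : Theory L.toLanguage}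

theorem isDeductive_provable : IsDeductive (L.Provable T) :=
  ⟨fun h => .ax (.rgl h), .mp⟩

theorem RGLAx.subst {L : FirstOrder.Language.{u, v}} {φ : Form L} (h : RGLAx φ)
    (s : ℕ → L.Term ℕ) : RGLAx (Form.subst s φ) := by
  cases h with
  | g1 φ ψ χ => exact .g1 _ _ _
  | g2 φ ψ => exact .g2 _ _
  | g3 φ ψ => exact .g3 _ _
  | g4 φ => exact .g4 _
  | g5 φ ψ χ => exact .g5 _ _ _
  | g6 φ ψ χ => exact .g6 _ _ _
  | g7 φ => exact .g7 _
  | all1 φ t =>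
    simp only [Form.subst, subst_inst]
    exact .all1 _ _
  | all2 φ ψ =>
    simp only [Form.subst, subst_up_shift]
    exact .all2 _ _
  | all3 φ ψ =>
    simp only [Form.subst, Form.or, subst_up_shift]
    exact .all3 _ _
  | ex1 φ t =>
    simp only [Form.subst, subst_inst]
    exact .ex1 _ _
  | ex2 φ ψ =>
    simp only [Form.subst, subst_up_shift]
    exact .ex2 _ _
  | rgl1 r s => exact .rgl1 _ _
  | rgl2_ge r s h => exact .rgl2_ge _ _ h
  | rgl2_lt r s h => exact .rgl2_lt _ _ h
  | rgl3 r h => exact .rgl3 _ h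

theorem freeBelow_dist {i j N : ℕ} (hi : i < N) (hj : j < N) :
    (L.dist (Term.var i) (Term.var j)).FreeBelow N := by
  intro k x hx
  fin_cases k
  · have : x = i := by simpa using hx
    omega
  · have : x = j := by simpa using hx
    omega

theorem freeBelow_distTuple (k : ℕ) : (L.distTuple k).FreeBelow (k + k) := by
  refine freeBelow_conj _ fun φ hφ => ?_
  obtain ⟨i, rfl⟩ := (List.mem_ofFn' _ _).1 hφ
  exact freeBelow_dist (by omega) (by omega)

theorem UltrametricLanguage.UMLAx.subst {φ : Form L.toLanguage} (h : L.UMLAx φ) (s : ℕ → L.Term ℕ) :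
    L.UMLAx (Form.subst s φ) := by
  have hx : ∀ {k : ℕ} (i : Fin k), ∀ x ∈ (L.xs k i).varFinset, x < k + k := by
    intro k i x hx
    have : x = i := by simpa [UltrametricLanguage.xs] using hx
    omega
  have hy : ∀ {k : ℕ} (i : Fin k), ∀ x ∈ (L.ys k i).varFinset, x < k + k := by
    intro k i x hx
    have : x = k + i := by simpa [UltrametricLanguage.ys] using hx
    omega
  cases h with
  | rgl h => exact .rgl (h.subst s)
  | s1 =>
    rw [subst_eq_self]
    · exact .s1
    · exact freeBelow_dist (by omega) (by omega)
  | s2 =>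
    rw [subst_eq_self]
    · exact .s2
    · exact ⟨freeBelow_dist (by omega) (by omega), freeBelow_dist (by omega) (by omega)⟩
  | s3 =>
    rw [subst_eq_self]
    · exact .s3
    · exact ⟨⟨freeBelow_dist (by omega) (by omega), freeBelow_dist (by omega) (by omega)⟩,
        freeBelow_dist (by omega) (by omega)⟩
  | @we1 k f n =>
    rw [subst_eq_self]
    · exact .we1 f n
    · refine freeBelow_alls _ ?_
      have h1 : (imp (L.distTuple k) (const (invConst (L.modFn f n)))).FreeBelow (0 + (k + k)) :=
        ⟨(freeBelow_distTuple k).mono (by omega), trivial⟩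
      have h2 : (imp (const (invConst n)) (L.dist (Term.func f (L.xs k))
          (Term.func f (L.ys k)))).FreeBelow (0 + (k + k)) := by
        refine ⟨trivial, fun i x hi => ?_⟩
        fin_cases i
        · obtain ⟨j, _, hj⟩ := Finset.mem_biUnion.1 (show x ∈ Finset.univ.biUnion _ from hi)
          have := hx j x hj
          omega
        · obtain ⟨j, _, hj⟩ := Finset.mem_biUnion.1 (show x ∈ Finset.univ.biUnion _ from hi)
          have := hy j x hj
          omega
      exact ⟨⟨⟨h1, h2⟩, h2⟩, ⟨⟨h2, h1⟩, h1⟩⟩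
  | @we2 k P n =>
    rw [subst_eq_self]
    · exact .we2 P n
    · refine freeBelow_alls _ ?_
      have h1 : (imp (L.distTuple k) (const (invConst (L.modPred P n)))).FreeBelow (0 + (k + k)) :=
        ⟨(freeBelow_distTuple k).mono (by omega), trivial⟩
      have h3 : (rel P (L.xs k)).FreeBelow (0 + (k + k)) := fun i x hi => by
        have := hx i x hi
        omega
      have h4 : (rel P (L.ys k)).FreeBelow (0 + (k + k)) := fun i x hi => by
        have := hy i x hi
        omega
      have h2 : (imp (const (invConst n)) (iff (rel P (L.xs k))
          (rel P (L.ys k)))).FreeBelow (0 + (k + k)) := ⟨trivial, ⟨h3, h4⟩, h4, h3⟩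
      exact ⟨⟨⟨h1, h2⟩, h2⟩, ⟨⟨h2, h1⟩, h1⟩⟩

theorem UltrametricLanguage.Provable.subst {φ : Form L.toLanguage} (h : L.Provable T φ) (s : ℕ → L.Term ℕ) :
    L.Provable T (Form.subst s φ) := by
  induction h generalizing s with
  | ax h => exact .ax (h.subst s)
  | hyp φ h =>
    rw [subst_eq_self φ.2]
    exact .hyp φ h
  | mp _ _ h1 h2 => exact .mp (h1 s) (h2 s)
  | gen _ h => exact .gen (h (up s))

/-- Derivability from a set of formulas, whose free variables are treated as constants. -/
inductive Der (T : Theory L.toLanguage) (G : Set (Form L.toLanguage)) : Form L.toLanguage → Prop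
  | base {φ} : L.Provable T φ → Der T G φ
  | hyp {φ} : φ ∈ G → Der T G φ
  | mp {φ ψ} : Der T G (imp φ ψ) → Der T G φ → Der T G ψ

theorem isDeductive_der (G : Set (Form L.toLanguage)) : IsDeductive (Der T G) :=
  ⟨fun h => .base (.ax (.rgl h)), .mp⟩

theorem Der.mono {G H : Set (Form L.toLanguage)} {φ : Form L.toLanguage} (h : Der T G φ)
    (hGH : G ⊆ H) : Der T H φ := by
  induction h with
  | base h => exact .base h
  | hyp h => exact .hyp (hGH h)
  | mp _ _ h1 h2 => exact .mp h1 h2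

theorem Der.cut {G H : Set (Form L.toLanguage)} {φ : Form L.toLanguage} (h : Der T G φ)
    (hGH : ∀ ψ ∈ G, Der T H ψ) : Der T H φ := by
  induction h with
  | base h => exact .base h
  | hyp h => exact hGH _ h
  | mp _ _ h1 h2 => exact .mp h1 h2

theorem provable_of_der_empty {φ : Form L.toLanguage} (h : Der T ∅ φ) : L.Provable T φ := by
  induction h with
  | base h => exact h
  | hyp h => exact absurd h (Set.notMem_empty _)
  | mp _ _ h1 h2 => exact .mp h1 h2

/-- The deduction theorem, for a directed set of additional hypotheses. -/
theorem Der.deduction_directed {G W : Set (Form L.toLanguage)} {φ : Form L.toLanguage}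
    (hW : ∀ a ∈ W, ∀ b ∈ W, ∃ c ∈ W, Der T G (imp c a) ∧ Der T G (imp c b))
    (h : Der T (G ∪ W) φ) : Der T G φ ∨ ∃ c ∈ W, Der T G (imp c φ) := by
  have hD := isDeductive_der (T := T) G
  induction h with
  | base h => exact Or.inl (.base h)
  | hyp h =>
    rcases h with h | h
    · exact Or.inl (.hyp h)
    · exact Or.inr ⟨_, h, hD.refl⟩
  | mp _ _ h1 h2 =>
    rcases h1 with h1 | ⟨a, ha, h1⟩
    · rcases h2 with h2 | ⟨b, hb, h2⟩
      · exact Or.inl (.mp h1 h2)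
      · exact Or.inr ⟨b, hb, hD.trans h2 h1⟩
    · rcases h2 with h2 | ⟨b, hb, h2⟩
      · exact Or.inr ⟨a, ha, hD.imp_mp h1 (hD.weaken h2)⟩
      -- Directedness replaces the two hypotheses by one that implies both, so a single element of
      -- `W` suffices for the whole derivation.
      · obtain ⟨c, hc, hca, hcb⟩ := hW a ha b hb
        exact Or.inr ⟨c, hc, hD.imp_mp (hD.trans hca h1) (hD.trans hcb h2)⟩

theorem Der.deduction {G : Set (Form L.toLanguage)} {φ ψ : Form L.toLanguage}
    (h : Der T (G ∪ {ψ}) φ) : Der T G (imp ψ φ) := by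
  have hD := isDeductive_der (T := T) G
  rcases Der.deduction_directed (by
    rintro a rfl b rfl
    exact ⟨_, rfl, hD.refl, hD.refl⟩) h with h | ⟨c, hc, h⟩
  · exact hD.weaken h
  · exact Set.mem_singleton_iff.1 hc ▸ h

/-- `Der` has no generalization rule, so quantifiers are introduced by induction: a hypothesis
through `γ → ∀ γ`, and modus ponens through the distribution of `∀` over implication. -/
theorem Der.of_shift {G : Set (Form L.toLanguage)} {φ : Form L.toLanguage}
    (h : Der T (shift '' G) φ) : Der T G (all φ) := by
  have hD := isDeductive_der (T := T) G
  have hP := isDeductive_provable (T := T)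
  induction h with
  | base h => exact .base (.gen h)
  | hyp h =>
    obtain ⟨γ, hγ, rfl⟩ := h
    exact .mp (.base (.mp (.ax (.rgl (.all2 _ γ))) (.gen hP.refl))) (.hyp hγ)
  | @mp φ ψ _ _ h1 h2 =>
    have inst_all : ∀ χ : Form L.toLanguage, L.Provable T (imp (shift (all χ)) χ) := by
      intro χ
      have h := RGLAx.all1 (Form.subst (up fun i => Term.var (i + 1)) χ) (Term.var 0)
      rw [inst_zero_shift] at h
      exact hP.ax h
    have key : L.Provable T (imp (shift (and (all (imp φ ψ)) (all φ))) ψ) :=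
      hP.uncurry (hP.swap (hP.trans (inst_all φ) (hP.swap (inst_all (imp φ ψ)))))
    exact .mp (.base (.mp (.ax (.rgl (.all2 _ _))) (.gen key))) (hD.and_intro h1 h2)

/-- Generalization over a variable that is not free in the hypotheses. -/
theorem Der.gen_fresh {N : ℕ} {G : Set (Form L.toLanguage)} (hG : ∀ γ ∈ G, γ.FreeBelow N)
    {φ : Form L.toLanguage} (hφ : φ.FreeBelow (N + 1)) (h : Der T G (inst (Term.var N) φ)) :
    Der T G (all φ) := by
  refine Der.of_shift ?_
  -- Since `N` is free in no hypothesis, the renaming `rotate N` carries every hypothesis to its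
  -- shift.
  rw [← subst_rotate_inst hφ]
  generalize inst (Term.var N) φ = ψ at h
  clear hφ φ
  induction h with
  | base h => exact .base (h.subst _)
  | hyp h => exact .hyp ⟨_, h, (subst_rotate (hG _ h)).symm⟩
  | mp _ _ h1 h2 => exact .mp h1 h2

/-- No positive rational constant is derivable. -/
def StrongCons (T : Theory L.toLanguage) (G : Set (Form L.toLanguage)) : Prop :=
  ∀ r : RatConst, 0 < r → ¬ Der T G (const r)

theorem strongCons_empty (h : L.StronglyConsistent T) : StrongCons T ∅ :=
  fun r hr hd => h r hr (provable_of_der_empty hd)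

theorem Der.const_of_or {G : Set (Form L.toLanguage)} {r s : RatConst}
    (h : Der T G (or (const r) (const s))) : Der T G (const (min r s)) :=
  have hD := isDeductive_der (T := T) G
  hD.or_elim (hD.ax (.rgl2_ge _ _ (min_le_left r s))) (hD.ax (.rgl2_ge _ _ (min_le_right r s))) h

/-- If a positive `r` became derivable, then by directedness one new hypothesis `φ(x) → s` would
imply it. Prelinearity gives `r ∨ (s → φ(x))`, and generalization over the fresh variable gives `r ∨
(s → ∀φ)`. As `∀φ → q` is in `G` and `s < q`, the second alternative yields `q`, so `min r q > 0`
would be derivable from `G`. -/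
theorem StrongCons.add_all_witness {N : ℕ} {G : Set (Form L.toLanguage)} (hG : StrongCons T G)
    (hN : ∀ γ ∈ G, γ.FreeBelow N) {φ : Form L.toLanguage} (hφ : φ.FreeBelow (N + 1)) :
    StrongCons T (G ∪ {χ | ∃ q s : RatConst, s < q ∧ imp (all φ) (const q) ∈ G ∧
      χ = imp (inst (Term.var N) φ) (const s)}) := by
  have hD := isDeductive_der (T := T) G
  intro r hr hd
  -- The hypothesis with the larger `s` implies the other one; the bound `q` plays no role in the
  -- comparison.
  rcases Der.deduction_directed (by
    rintro _ ⟨q, s, hsq, hq, rfl⟩ _ ⟨q', s', hsq', hq', rfl⟩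
    rcases le_total s s' with h | h
    · exact ⟨_, ⟨q', s', hsq', hq', rfl⟩, hD.imp_right (hD.ax (.rgl2_ge _ _ h)), hD.refl⟩
    · exact ⟨_, ⟨q, s, hsq, hq, rfl⟩, hD.refl, hD.imp_right (hD.ax (.rgl2_ge _ _ h))⟩)
    hd with h | ⟨_, ⟨q, s, hsq, hq, rfl⟩, h⟩
  · exact hG r hr h
  · have h1 : Der T G (inst (Term.var N) (or (const r) (imp (const s) φ))) :=
      hD.linear (hD.trans h hD.or_inl) hD.or_inr
    have h2 : Der T G (all (or (shift (const r)) (imp (shift (const s)) φ))) :=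
      Der.gen_fresh hN ⟨⟨⟨trivial, ⟨trivial, hφ⟩⟩, ⟨trivial, hφ⟩⟩,
        ⟨⟨⟨trivial, hφ⟩, trivial⟩, trivial⟩⟩ h1
    have h3 := hD.mp (hD.ax (.all3 _ _)) h2
    have h4 : Der T G (imp (all (imp (shift (const s)) φ)) (const q)) :=
      hD.trans (hD.trans (hD.ax (.all2 φ (const s))) (hD.imp_right (.hyp hq)))
        (hD.iff_mp (hD.ax (.rgl2_lt s q hsq)))
    have h5 := Der.const_of_or (hD.or_elim hD.or_inl (hD.trans h4 hD.or_inr) h3)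
    exact hG _ (lt_min hr (lt_of_le_of_lt s.2.1 hsq)) h5

/-- Dually, a contradiction would give `r ∨ (∃φ → s)`. With `q → ∃φ` in `G` and `q < s` the second
alternative yields `s`, which is positive. -/
theorem StrongCons.add_ex_witness {N : ℕ} {G : Set (Form L.toLanguage)} (hG : StrongCons T G)
    (hN : ∀ γ ∈ G, γ.FreeBelow N) {φ : Form L.toLanguage} (hφ : φ.FreeBelow (N + 1)) :
    StrongCons T (G ∪ {χ | ∃ q s : RatConst, q < s ∧ imp (const q) (ex φ) ∈ G ∧
      χ = imp (const s) (inst (Term.var N) φ)}) := by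
  have hD := isDeductive_der (T := T) G
  intro r hr hd
  rcases Der.deduction_directed (by
    rintro _ ⟨q, s, hsq, hq, rfl⟩ _ ⟨q', s', hsq', hq', rfl⟩
    rcases le_total s s' with h | h
    · exact ⟨_, ⟨q, s, hsq, hq, rfl⟩, hD.refl, hD.imp_left (hD.ax (.rgl2_ge _ _ h))⟩
    · exact ⟨_, ⟨q', s', hsq', hq', rfl⟩, hD.imp_left (hD.ax (.rgl2_ge _ _ h)), hD.refl⟩)
    hd with h | ⟨_, ⟨q, s, hsq, hq, rfl⟩, h⟩
  · exact hG r hr h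
  · have h1 : Der T G (inst (Term.var N) (or (const r) (imp φ (const s)))) :=
      hD.linear (hD.trans h hD.or_inl) hD.or_inr
    have h2 : Der T G (all (or (shift (const r)) (imp φ (shift (const s))))) :=
      Der.gen_fresh hN ⟨⟨⟨trivial, ⟨hφ, trivial⟩⟩, ⟨hφ, trivial⟩⟩,
        ⟨⟨⟨hφ, trivial⟩, trivial⟩, trivial⟩⟩ h1
    have h3 := hD.mp (hD.ax (.all3 _ _)) h2
    have h4 : Der T G (imp (all (imp φ (shift (const s)))) (const s)) :=
      hD.trans (hD.trans (hD.ax (.ex2 φ (const s))) (hD.imp_left (.hyp hq)))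
        (hD.iff_mp (hD.ax (.rgl2_lt q s hsq)))
    have h5 := Der.const_of_or (hD.or_elim hD.or_inl (hD.trans h4 hD.or_inr) h3)
    exact hG _ (lt_min hr (lt_of_le_of_lt q.2.1 hsq)) h5

end Derivations

/-! ### Maximal strongly consistent sets and the Henkin construction -/

section Henkin

variable {L : UltrametricLanguage.{u, v}} {T : Theory L.toLanguage}

theorem Der.exists_of_sUnion {c : Set (Set (Form L.toLanguage))} (hc : IsChain (· ⊆ ·) c)
    (hne : c.Nonempty) {φ : Form L.toLanguage} (h : Der T (⋃₀ c) φ) : ∃ G ∈ c, Der T G φ := by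
  induction h with
  | base h =>
    obtain ⟨G, hG⟩ := hne
    exact ⟨G, hG, .base h⟩
  | hyp h =>
    obtain ⟨G, hG, h⟩ := h
    exact ⟨G, hG, .hyp h⟩
  | mp _ _ h1 h2 =>
    obtain ⟨G, hG, h1⟩ := h1
    obtain ⟨H, hH, h2⟩ := h2
    rcases hc.total hG hH with h | h
    · exact ⟨H, hH, .mp (h1.mono h) h2⟩
    · exact ⟨G, hG, .mp h1 (h2.mono h)⟩

/-- `G` is maximal among the strongly consistent sets of formulas with free variables
below `N`. -/
structure IsMaximalBelow (T : Theory L.toLanguage) (N : ℕ) (G : Set (Form L.toLanguage)) :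
    Prop where
  cons : StrongCons T G
  below : ∀ γ ∈ G, γ.FreeBelow N
  mem : ∀ φ : Form L.toLanguage, φ.FreeBelow N → StrongCons T (G ∪ {φ}) → φ ∈ G

theorem StrongCons.exists_maximal {N : ℕ} {G : Set (Form L.toLanguage)} (hG : StrongCons T G)
    (hN : ∀ γ ∈ G, γ.FreeBelow N) : ∃ M, G ⊆ M ∧ IsMaximalBelow T N M := by
  obtain ⟨M, hGM, hM⟩ := zorn_subset_nonempty
    {H : Set (Form L.toLanguage) | StrongCons T H ∧ ∀ γ ∈ H, γ.FreeBelow N} (by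
      intro c hcS hc hne
      refine ⟨⋃₀ c, ⟨fun r hr hd => ?_, ?_⟩, fun s hs => Set.subset_sUnion_of_mem hs⟩
      · obtain ⟨H, hH, hd⟩ := Der.exists_of_sUnion hc hne hd
        exact (hcS hH).1 r hr hd
      · rintro γ ⟨H, hH, hγ⟩
        exact (hcS hH).2 γ hγ) G ⟨hG, hN⟩
  refine ⟨M, hGM, hM.1.1, hM.1.2, fun φ hφ hc => ?_⟩
  refine hM.2 ⟨hc, ?_⟩ Set.subset_union_left (Or.inr rfl)
  rintro γ (hγ | rfl)
  · exact hM.1.2 γ hγ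
  · exact hφ

theorem IsMaximalBelow.mem_of_der {N : ℕ} {G : Set (Form L.toLanguage)}
    (hG : IsMaximalBelow T N G) {φ : Form L.toLanguage} (hφ : φ.FreeBelow N) (h : Der T G φ) :
    φ ∈ G := by
  refine hG.mem φ hφ fun r hr hd => hG.cons r hr (hd.cut ?_)
  rintro ψ (hψ | rfl)
  · exact .hyp hψ
  · exact h

/-- A strongly consistent set of formulas that decides the order of the formulas and has
witnesses that approximate the values of the quantified formulas. -/
structure IsHenkin (T : Theory L.toLanguage) (G : Set (Form L.toLanguage)) : Prop where
  cons : StrongCons T G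
  closed : ∀ {φ}, Der T G φ → φ ∈ G
  mem_or : ∀ φ, φ ∈ G ∨ ∃ r : RatConst, 0 < r ∧ imp φ (const r) ∈ G
  all_witness : ∀ φ, ∃ t : L.Term ℕ, ∀ q s : RatConst, s < q → imp (all φ) (const q) ∈ G →
    imp (inst t φ) (const s) ∈ G
  ex_witness : ∀ φ, ∃ t : L.Term ℕ, ∀ q s : RatConst, q < s → imp (const q) (ex φ) ∈ G →
    imp (const s) (inst t φ) ∈ G

/-- Bounding the free variables of `G` by `N` keeps the variable `N` fresh to serve as a witness.
The Boolean selects the quantifier that is treated. -/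
theorem IsMaximalBelow.exists_step {N : ℕ} {G : Set (Form L.toLanguage)}
    (hG : IsMaximalBelow T N G) (φ : Form L.toLanguage) (b : Bool) :
    ∃ H, IsMaximalBelow T (N + 1) H ∧ G ⊆ H ∧ (φ.FreeBelow (N + 1) →
      (b = true → ∀ q s : RatConst, s < q → imp (all φ) (const q) ∈ G →
        imp (inst (Term.var N) φ) (const s) ∈ H) ∧
      (b = false → ∀ q s : RatConst, q < s → imp (const q) (ex φ) ∈ G →
        imp (const s) (inst (Term.var N) φ) ∈ H)) := by
  have hbelow : ∀ γ ∈ G, γ.FreeBelow (N + 1) := fun γ hγ => (hG.below γ hγ).mono (by omega)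
  by_cases hφ : φ.FreeBelow (N + 1)
  · cases b with
    | true =>
      obtain ⟨H, hGH, hH⟩ := (hG.cons.add_all_witness hG.below hφ).exists_maximal (N := N + 1) (by
        rintro γ (hγ | ⟨q, s, _, _, rfl⟩)
        · exact hbelow γ hγ
        · exact ⟨hφ.inst_var, trivial⟩)
      exact ⟨H, hH, Set.subset_union_left.trans hGH, fun _ =>
        ⟨fun _ q s hsq hq => hGH (Or.inr ⟨q, s, hsq, hq, rfl⟩), by simp⟩⟩
    | false =>
      obtain ⟨H, hGH, hH⟩ := (hG.cons.add_ex_witness hG.below hφ).exists_maximal (N := N + 1) (by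
        rintro γ (hγ | ⟨q, s, _, _, rfl⟩)
        · exact hbelow γ hγ
        · exact ⟨trivial, hφ.inst_var⟩)
      exact ⟨H, hH, Set.subset_union_left.trans hGH, fun _ =>
        ⟨by simp, fun _ q s hsq hq => hGH (Or.inr ⟨q, s, hsq, hq, rfl⟩)⟩⟩
  · obtain ⟨H, hGH, hH⟩ := hG.cons.exists_maximal hbelow
    exact ⟨H, hH, hGH, fun h => absurd h hφ⟩

theorem exists_isHenkin [Countable (Form L.toLanguage)] (hT : L.StronglyConsistent T) :
    ∃ G, IsHenkin T G := by
  have : Nonempty (Form L.toLanguage × Bool) := ⟨const 0, true⟩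
  obtain ⟨e, he⟩ := exists_surjective_nat (Form L.toLanguage × Bool)
  obtain ⟨G₀, _, hG₀⟩ := (strongCons_empty hT).exists_maximal (N := 0) (by simp)
  choose F hF1 hF2 hF3 using fun (N : ℕ) (G : {G // IsMaximalBelow T N G}) =>
    G.2.exists_step (e N.unpair.1).1 (e N.unpair.1).2
  let Γ : ∀ N, {G // IsMaximalBelow T N G} := fun N =>
    Nat.rec (motive := fun N => {G // IsMaximalBelow T N G}) ⟨G₀, hG₀⟩
      (fun N G => ⟨F N G, hF1 N G⟩) N
  let g : ℕ → Set (Form L.toLanguage) := fun N => (Γ N).1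
  have hmax : ∀ N, IsMaximalBelow T N (g N) := fun N => (Γ N).2
  have hmono : Monotone g := monotone_nat_of_le_succ fun N => hF2 N (Γ N)
  have hstep : ∀ N, _ := fun N => hF3 N (Γ N)
  let G : Set (Form L.toLanguage) := ⋃₀ Set.range g
  have hsub : ∀ N, g N ⊆ G := fun N => Set.subset_sUnion_of_mem ⟨N, rfl⟩
  -- Maximality at stage `N` already decides all formulas with free variables below `N`. Hence no
  -- bound on `all φ` or `ex φ` appears after the stage that treats it, and one stage for each
  -- quantified formula is enough.
  have hmem : ∀ (N : ℕ) (φ : Form L.toLanguage), φ.FreeBelow N → φ ∈ G → φ ∈ g N := by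
    rintro N φ hφ ⟨_, ⟨M, rfl⟩, h⟩
    refine (hmax N).mem φ hφ fun r hr hd => (hmax (max M N)).cons r hr (hd.mono ?_)
    rintro ψ (hψ | rfl)
    · exact hmono (le_max_right M N) hψ
    · exact hmono (le_max_left M N) h
  have hder : ∀ φ, Der T G φ → ∃ N, Der T (g N) φ := by
    intro φ h
    obtain ⟨_, ⟨N, rfl⟩, h⟩ := Der.exists_of_sUnion hmono.isChain_range ⟨_, 0, rfl⟩ h
    exact ⟨N, h⟩
  have htask : ∀ (φ : Form L.toLanguage) (b : Bool), ∃ N, φ.FreeBelow N ∧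
      e N.unpair.1 = (φ, b) := by
    intro φ b
    obtain ⟨n, hn⟩ := he (φ, b)
    obtain ⟨m, hm⟩ := exists_freeBelow φ
    -- The second component of the stage is a bound for the free variables; it delays the task until
    -- they all lie below the stage number.
    exact ⟨Nat.pair n m, hm.mono (Nat.right_le_pair n m), by rw [Nat.unpair_pair, hn]⟩
  refine ⟨G, ?_, ?_, ?_, ?_, ?_⟩
  · intro r hr hd
    obtain ⟨N, h⟩ := hder _ hd
    exact (hmax N).cons r hr h
  · intro φ h
    obtain ⟨N, h⟩ := hder _ h
    obtain ⟨M, hM⟩ := exists_freeBelow φ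
    exact hsub (max N M) ((hmax _).mem_of_der (hM.mono (le_max_right _ _))
      (h.mono (hmono (le_max_left _ _))))
  · intro φ
    obtain ⟨N, hN⟩ := exists_freeBelow φ
    by_cases h : StrongCons T (g N ∪ {φ})
    · exact Or.inl (hsub N ((hmax N).mem φ hN h))
    · obtain ⟨r, hr, hd⟩ : ∃ r : RatConst, 0 < r ∧ Der T (g N ∪ {φ}) (const r) := by
        by_contra! hcon
        exact h fun r hr hd => hcon r hr hd
      exact Or.inr ⟨r, hr, hsub N ((hmax N).mem_of_der ⟨hN, trivial⟩ hd.deduction)⟩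
  · intro φ
    obtain ⟨N, hN, hN'⟩ := htask φ true
    have h := hstep N
    rw [hN'] at h
    refine ⟨Term.var N, fun q s hsq hq => hsub (N + 1) ?_⟩
    exact (h (hN.mono (by omega))).1 rfl q s hsq
      (hmem N _ ⟨hN.mono (M := N + 1) (by omega), trivial⟩ hq)
  · intro φ
    obtain ⟨N, hN, hN'⟩ := htask φ false
    have h := hstep N
    rw [hN'] at h
    refine ⟨Term.var N, fun q s hsq hq => hsub (N + 1) ?_⟩
    exact (h (hN.mono (by omega))).2 rfl q s hsq
      (hmem N _ ⟨trivial, hN.mono (M := N + 1) (by omega)⟩ hq)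

namespace IsHenkin

variable {G : Set (Form L.toLanguage)} (hG : IsHenkin T G)

include hG

theorem isDeductive : IsDeductive (· ∈ G) :=
  ⟨fun h => hG.closed (.base (.ax (.rgl h))), fun h1 h2 => hG.closed (.mp (.hyp h1) (.hyp h2))⟩

theorem const_notMem {r : RatConst} (hr : 0 < r) : const r ∉ G := fun h => hG.cons r hr (.hyp h)

/-- If both implications failed, each would imply a positive constant, and prelinearity would put
the smaller constant in `G`. -/
theorem total (φ ψ : Form L.toLanguage) : imp φ ψ ∈ G ∨ imp ψ φ ∈ G := by
  have hD := hG.isDeductive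
  rcases hG.mem_or (imp φ ψ) with h | ⟨r, hr, h1⟩
  · exact Or.inl h
  rcases hG.mem_or (imp ψ φ) with h | ⟨s, hs, h2⟩
  · exact Or.inr h
  refine absurd ?_ (hG.const_notMem (lt_min hr hs))
  exact hD.linear (hD.imp_const_mono (min_le_left r s) h1) (hD.imp_const_mono (min_le_right r s) h2)

/-- If `all φ` is missing, `G` bounds it below by some `r > 0`; the witness instance is then bounded
below by any positive `s < r`, so it cannot be in `G`. -/
theorem all_mem {φ : Form L.toLanguage} (h : ∀ t, inst t φ ∈ G) : all φ ∈ G := by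
  have hD := hG.isDeductive
  rcases hG.mem_or (all φ) with h' | ⟨r, hr, h'⟩
  · exact h'
  obtain ⟨t, ht⟩ := hG.all_witness φ
  obtain ⟨s, hs0, hsr⟩ := exists_between hr
  exact absurd (hD.mp (ht r s hsr h') (h t)) (hG.const_notMem hs0)

end IsHenkin

end Henkin

/-! ### The valuation given by a Henkin set, and the term model -/

section TermModel

variable {L : UltrametricLanguage.{u, v}} {T : Theory L.toLanguage}

/-- A Henkin set gives the formulas truth values that respect the connectives and, with terms as
the instances, the quantifiers. -/
theorem IsHenkin.exists_valuation [Countable (Form L.toLanguage)] {G : Set (Form L.toLanguage)}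
    (hG : IsHenkin T G) :
    ∃ V : Form L.toLanguage → TruthValue, (∀ r, V (const r) = hat r) ∧ (∀ φ ∈ G, V φ = hat 0) ∧
      (∀ φ ψ, V (and φ ψ) = max (V φ) (V ψ)) ∧ (∀ φ ψ, V (imp φ ψ) = impVal (V φ) (V ψ)) ∧
      (∀ φ, IsLUB (Set.range fun t => V (inst t φ)) (V (all φ))) ∧
      (∀ φ, IsGLB (Set.range fun t => V (inst t φ)) (V (ex φ))) := by
  classical
  have hD := hG.isDeductive
  -- The order is reversed against implication, because smaller truth values are truer.
  let : Preorder (Form L.toLanguage) :=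
    { le := fun φ ψ => imp ψ φ ∈ G
      le_refl := fun φ => hD.refl
      le_trans := fun φ ψ χ h1 h2 => hD.trans h2 h1 }
  let A := Antisymmetrization (Form L.toLanguage) (· ≤ ·)
  let q : Form L.toLanguage → A := toAntisymmetrization (· ≤ ·)
  have q_le : ∀ φ ψ, q φ ≤ q ψ ↔ imp ψ φ ∈ G := fun φ ψ => Iff.rfl
  have q_surj : ∀ a : A, ∃ φ, q φ = a := Quotient.exists_rep
  let : LinearOrder A :=
    { (inferInstance : PartialOrder A) with
      le_total := fun a b => by
        obtain ⟨φ, rfl⟩ := q_surj a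
        obtain ⟨ψ, rfl⟩ := q_surj b
        exact hG.total ψ φ
      toDecidableLE := Classical.decRel _ }
  have : Countable A := Function.Surjective.countable q_surj
  have hc : StrictMono fun r : RatConst => q (const r) := by
    intro r s hrs
    refine lt_of_le_not_ge (hD.ax (.rgl2_ge s r hrs.le)) fun h => ?_
    exact hG.const_notMem (lt_of_le_of_lt r.2.1 hrs) (hD.const_of_imp hrs h)
  have htop : IsTop (q (const 1)) := by
    intro a
    obtain ⟨φ, rfl⟩ := q_surj a
    exact hD.ax (.g7 φ)
  obtain ⟨W, W1, W2, W3, W4, W5, W6⟩ := exists_truthValue_map hc htop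
  have W0 : ∀ φ ∈ G, W (q φ) = hat 0 := fun φ hφ =>
    W3 _ fun r hr h => hG.const_notMem hr (hD.mp h hφ)
  refine ⟨fun φ => W (q φ), W1, W0, ?_, ?_, ?_, ?_⟩
  · intro φ ψ
    rcases hG.total φ ψ with h | h
    · have h1 : q (and φ ψ) = q φ := le_antisymm (hD.imp_and hD.refl h) hD.and_left
      simp only [h1]
      exact (max_eq_left (W2 h)).symm
    · have h1 : q (and φ ψ) = q ψ := le_antisymm (hD.imp_and h hD.refl) hD.and_right
      simp only [h1]
      exact (max_eq_right (W2 h)).symm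
  · intro φ ψ
    by_cases h : imp φ ψ ∈ G
    · simp only [W0 _ h, impVal]
      rw [if_pos (W2 h)]
    -- By totality and contraction a false implication implies its premise, hence its conclusion; so
    -- it is equivalent to the conclusion.
    · have h1 : imp (imp φ ψ) φ ∈ G := by
        rcases hG.total φ (imp φ ψ) with h' | h'
        · exact absurd (hD.contract h') h
        · exact h'
      have h2 : q (imp φ ψ) = q ψ :=
        le_antisymm (hD.curry hD.and_left) (hD.imp_mp hD.refl h1)
      have h3 : q φ < q ψ := lt_of_not_ge h
      simp only [h2, impVal]
      rcases W4 _ _ h3 with h4 | h4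
      · rw [if_neg (not_le.2 h4)]
      -- Here the order is strict in `A`, but `ψ` is infinitesimal and both branches of `impVal` are
      -- `0̂`.
      · rw [h4, ite_self]
  · intro φ
    have hlub : IsLUB (Set.range fun t => q (inst t φ)) (q (all φ)) := by
      refine ⟨?_, ?_⟩
      · rintro _ ⟨t, rfl⟩
        exact hD.ax (.all1 φ t)
      · intro b hb
        obtain ⟨χ, rfl⟩ := q_surj b
        refine hD.mp (hD.ax (.all2 φ χ)) (hG.all_mem fun t => ?_)
        have : inst t (imp (shift χ) φ) = imp χ (inst t φ) := by
          rw [← inst_shift t χ, inst_shift t χ]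
          exact congrArg₂ imp (inst_shift t χ) rfl
        rw [this]
        exact hb ⟨t, rfl⟩
    obtain ⟨t, ht⟩ := hG.all_witness φ
    have := W5 _ _ hlub ⟨_, ⟨t, rfl⟩, fun r r' h h' => ht r' r h h'⟩
    rwa [← Set.range_comp] at this
  · intro φ
    have hglb : IsGLB (Set.range fun t => q (inst t φ)) (q (ex φ)) := by
      refine ⟨?_, ?_⟩
      · rintro _ ⟨t, rfl⟩
        exact hD.ax (.ex1 φ t)
      · intro b hb
        obtain ⟨χ, rfl⟩ := q_surj b
        refine hD.mp (hD.ax (.ex2 φ χ)) (hG.all_mem fun t => ?_)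
        have : inst t (imp φ (shift χ)) = imp (inst t φ) χ :=
          congrArg₂ imp rfl (inst_shift t χ)
        rw [this]
        exact hb ⟨t, rfl⟩
    obtain ⟨t, ht⟩ := hG.ex_witness φ
    have := W6 _ _ hglb ⟨_, ⟨t, rfl⟩, fun r r' h h' => ht r r' h h'⟩
    rwa [← Set.range_comp] at this

/-- The structure of terms, with predicates interpreted by a valuation. -/
def termStruct (V : Form L.toLanguage → TruthValue) : Struct.{u, v, u} L.toLanguage where
  carrier := L.Term ℕ
  nonempty := ⟨Term.var 0⟩
  fn f ts := Term.func f ts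
  pred P ts := V (rel P ts)

theorem termVal_termStruct (V : Form L.toLanguage → TruthValue) (σ : ℕ → L.Term ℕ)
    (t : L.Term ℕ) : (termStruct V).termVal σ t = t.subst σ := by
  induction t with
  | var => rfl
  | func f ts ih =>
    change Term.func f _ = Term.func f _
    congr 1
    funext i
    exact ih i

/-- The truth lemma: an assignment in the term model is a substitution, and an instance by an
element of the model is an instance by a term. -/
theorem val_termStruct {V : Form L.toLanguage → TruthValue} (h1 : ∀ r, V (const r) = hat r)
    (h2 : ∀ φ ψ, V (and φ ψ) = max (V φ) (V ψ)) (h3 : ∀ φ ψ, V (imp φ ψ) = impVal (V φ) (V ψ))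
    (h4 : ∀ φ, IsLUB (Set.range fun t => V (inst t φ)) (V (all φ)))
    (h5 : ∀ φ, IsGLB (Set.range fun t => V (inst t φ)) (V (ex φ)))
    (σ : ℕ → L.Term ℕ) (φ : Form L.toLanguage) :
    (termStruct V).val σ φ = V (subst σ φ) := by
  have hpush : ∀ (t : L.Term ℕ) (σ : ℕ → L.Term ℕ),
      (termStruct V).push t σ = fun i => Nat.casesOn i t σ := by
    intro t σ
    funext i
    cases i <;> rfl
  induction φ generalizing σ with
  | const r => exact (h1 r).symm
  | rel P ts =>
    change V (rel P _) = V (rel P _)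
    congr 2
    funext i
    exact termVal_termStruct V σ (ts i)
  | and φ ψ ih1 ih2 => simp only [Struct.val, subst, h2, ih1, ih2]
  | imp φ ψ ih1 ih2 => simp only [Struct.val, subst, h3, ih1, ih2]
  | all φ ih =>
    refine Eq.trans ?_ (h4 (subst (up σ) φ)).iSup_eq
    refine iSup_congr fun t => ?_
    exact (ih _).trans (congrArg V ((congrArg (subst · φ) (hpush t σ)).trans
      (inst_subst_up t σ φ).symm))
  | ex φ ih =>
    refine Eq.trans ?_ (h5 (subst (up σ) φ)).iInf_eq
    refine iInf_congr fun t => ?_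
    exact (ih _).trans (congrArg V ((congrArg (subst · φ) (hpush t σ)).trans
      (inst_subst_up t σ φ).symm))

/-- A strongly consistent theory has a countable structure that satisfies everything that the
theory proves. -/
theorem exists_struct_of_stronglyConsistent [Countable L.Symbols] (hT : L.StronglyConsistent T) :
    ∃ M : Struct.{u, v, u} L.toLanguage, Countable M.carrier ∧
      ∀ φ, L.Provable T φ → ∀ σ, M.val σ φ = hat 0 := by
  have := countable_form (L := L.toLanguage)
  obtain ⟨G, hG⟩ := exists_isHenkin hT
  obtain ⟨V, h1, h0, h2, h3, h4, h5⟩ := hG.exists_valuation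
  refine ⟨termStruct V, inferInstanceAs (Countable (L.Term ℕ)), fun φ hφ σ => ?_⟩
  exact (val_termStruct h1 h2 h3 h4 h5 σ φ).trans (h0 _ (hG.closed (.base (hφ.subst σ))))

end TermModel

/-! ### Truth functions -/

section TruthFunctions

theorem hat_zero_le (x : TruthValue) : hat 0 ≤ x := by
  rw [TruthValue.le_def]
  have h : (hat 0).fst = 0 := by rw [hat_fst]; simp
  have h' : (hat 0).snd = 0 := by rw [hat_snd]; simp
  rw [h, h']
  exact (lt_or_eq_of_le x.2.1.1).imp id fun h => ⟨h, x.2.2.1.1⟩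

theorem le_hat_one (x : TruthValue) : x ≤ hat 1 := by
  rw [TruthValue.le_def]
  have h : (hat 1).fst = 1 := by rw [hat_fst]; simp
  have h' : (hat 1).snd = 1 := by rw [hat_snd]; simp
  rw [h, h']
  exact (lt_or_eq_of_le x.2.1.2).imp id fun h => ⟨h, x.2.2.1.2⟩

theorem hat_strictMono : StrictMono hat := by
  intro r s h
  refine lt_of_not_ge fun hle => ?_
  have h1 := TruthValue.fst_mono hle
  rw [hat_fst, hat_fst] at h1
  have h2 : ((r : ℚ) : ℝ) < ((s : ℚ) : ℝ) := by exact_mod_cast h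
  exact absurd h1 (not_le.2 h2)

theorem eq_hat_zero_of_le {x : TruthValue} (h : x ≤ hat 0) : x = hat 0 :=
  le_antisymm h (hat_zero_le x)

theorem invConst_pos (n : ℕ+) : 0 < invConst n := by
  change (0 : ℚ) < ((n : ℕ) : ℚ)⁻¹
  positivity

/-- The first coordinate must vanish, and the points `(0, r)` with `r > 0` have been removed from
the set of truth values. -/
theorem eq_hat_zero_of_forall_le {x : TruthValue} (h : ∀ n, x ≤ hat (invConst n)) :
    x = hat 0 := by
  refine eq_hat_zero (le_antisymm (le_of_not_gt fun h0 => ?_) x.2.1.1)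
  obtain ⟨n, hn⟩ := exists_nat_one_div_lt h0
  have h1 := TruthValue.fst_mono (h n.succPNat)
  rw [hat_fst] at h1
  have h2 : (((invConst n.succPNat : RatConst) : ℚ) : ℝ) = 1 / ((n : ℝ) + 1) := by
    simp [invConst]
  rw [h2] at h1
  exact absurd hn (not_lt.2 h1)

/-- This is residuation, with the order reversed; most propositional axioms reduce to it. -/
theorem impVal_le_iff {x y z : TruthValue} : impVal x y ≤ z ↔ y ≤ max x z := by
  unfold impVal
  split_ifs with h
  · exact iff_of_true (hat_zero_le z) (h.trans (le_max_left _ _))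
  · rw [le_max_iff, or_iff_right h]

theorem impVal_eq_zero_iff {x y : TruthValue} : impVal x y = hat 0 ↔ y ≤ x := by
  rw [← max_eq_left (hat_zero_le x), ← impVal_le_iff, max_eq_left (hat_zero_le x)]
  exact ⟨le_of_eq, eq_hat_zero_of_le⟩

theorem le_max_impVal (x y : TruthValue) : y ≤ max x (impVal x y) := impVal_le_iff.1 le_rfl

theorem impVal_zero_left (x : TruthValue) : impVal (hat 0) x = x := by
  unfold impVal
  split_ifs with h
  · exact (eq_hat_zero_of_le h).symm
  · rfl

theorem max_eq_zero_iff {x y : TruthValue} : max x y = hat 0 ↔ x = hat 0 ∧ y = hat 0 := by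
  constructor
  · intro h
    exact ⟨eq_hat_zero_of_le (h ▸ le_max_left x y), eq_hat_zero_of_le (h ▸ le_max_right x y)⟩
  · rintro ⟨rfl, rfl⟩
    exact max_self _

/-- This computes the defined disjunction: the conjunct whose inner implication is true returns the
smaller value, and the other one never exceeds it. -/
theorem max_impVal_impVal (x y : TruthValue) :
    max (impVal (impVal x y) y) (impVal (impVal y x) x) = min x y := by
  have key : ∀ x y : TruthValue, x ≤ y →
      max (impVal (impVal x y) y) (impVal (impVal y x) x) = x := by
    intro x y h
    rw [impVal_eq_zero_iff.2 h, impVal_zero_left]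
    rcases h.eq_or_lt with rfl | h
    · rw [impVal_eq_zero_iff.2 le_rfl, impVal_zero_left, max_self]
    · have : impVal x y = y := if_neg (not_le.2 h)
      rw [this, impVal_eq_zero_iff.2 le_rfl, max_eq_right (hat_zero_le x)]
  rcases le_total x y with h | h
  · rw [key x y h, min_eq_left h]
  · rw [max_comm, key y x h, min_eq_right h]

theorem max_impVal_eq_dmax (x y : TruthValue) : max (impVal x y) (impVal y x) = dmax x y := by
  unfold dmax impVal
  rcases lt_trichotomy x y with h | rfl | h
  · rw [if_neg h.ne, if_neg (not_le.2 h), if_pos h.le, max_eq_left (hat_zero_le _),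
      max_eq_right h.le]
  · simp
  · rw [if_neg h.ne', if_neg (not_le.2 h), if_pos h.le, max_eq_right (hat_zero_le _),
      max_eq_left h.le]

theorem eq_of_dmax_eq_zero {x y : TruthValue} (h : dmax x y = hat 0) : x = y := by
  unfold dmax at h
  split_ifs at h with hxy
  · exact hxy
  · rw [(max_eq_zero_iff.1 h).1, (max_eq_zero_iff.1 h).2]

theorem iSup_eq_hat_zero_iff {ι : Type*} {f : ι → TruthValue} :
    ⨆ i, f i = hat 0 ↔ ∀ i, f i = hat 0 :=
  ⟨fun h i => eq_hat_zero_of_le (h ▸ le_iSup f i),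
    fun h => eq_hat_zero_of_le (iSup_le fun i => (h i).le)⟩

end TruthFunctions

/-! ### Substitution lemma and soundness of the logical axioms -/

section Semantics

variable {L : FirstOrder.Language.{u, v}} (M : Struct.{u, v, w} L)

namespace Struct

theorem termVal_relabel (σ : ℕ → M.carrier) (g : ℕ → ℕ) (t : L.Term ℕ) :
    M.termVal σ (t.relabel g) = M.termVal (σ ∘ g) t := by
  induction t with
  | var => rfl
  | func f ts ih =>
    simp only [Term.relabel, termVal]
    congr 1
    funext i
    exact ih i

theorem termVal_subst (σ : ℕ → M.carrier) (s : ℕ → L.Term ℕ) (t : L.Term ℕ) :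
    M.termVal σ (t.subst s) = M.termVal (fun i => M.termVal σ (s i)) t := by
  induction t with
  | var => rfl
  | func f ts ih =>
    simp only [Term.subst, termVal]
    congr 1
    funext i
    exact ih i

theorem push_up (σ : ℕ → M.carrier) (s : ℕ → L.Term ℕ) (a : M.carrier) :
    (fun i => M.termVal (M.push a σ) (up s i)) = M.push a fun i => M.termVal σ (s i) := by
  funext i
  cases i with
  | zero => rfl
  | succ i => exact M.termVal_relabel _ _ _

theorem val_subst (σ : ℕ → M.carrier) (s : ℕ → L.Term ℕ) (φ : Form L) :
    M.val σ (subst s φ) = M.val (fun i => M.termVal σ (s i)) φ := by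
  induction φ generalizing σ s with
  | const r => rfl
  | rel P ts => simp only [subst, val, termVal_subst]
  | and φ ψ h1 h2 => simp only [subst, val, h1, h2]
  | imp φ ψ h1 h2 => simp only [subst, val, h1, h2]
  | all φ ih => simp only [subst, val, ih, push_up]
  | ex φ ih => simp only [subst, val, ih, push_up]

theorem val_shift (σ : ℕ → M.carrier) (a : M.carrier) (φ : Form L) :
    M.val (M.push a σ) (shift φ) = M.val σ φ := M.val_subst _ _ _

theorem val_inst (σ : ℕ → M.carrier) (t : L.Term ℕ) (φ : Form L) :
    M.val σ (inst t φ) = M.val (M.push (M.termVal σ t) σ) φ := by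
  rw [inst_eq, val_subst]
  congr 1
  funext i
  cases i <;> rfl

theorem val_or (σ : ℕ → M.carrier) (φ ψ : Form L) :
    M.val σ (or φ ψ) = min (M.val σ φ) (M.val σ ψ) := max_impVal_impVal _ _

theorem val_or_eq_zero (σ : ℕ → M.carrier) (φ ψ : Form L) :
    M.val σ (or φ ψ) = hat 0 ↔ M.val σ φ = hat 0 ∨ M.val σ ψ = hat 0 := by
  rw [val_or]
  constructor
  · intro h
    rcases le_total (M.val σ φ) (M.val σ ψ) with h' | h'
    · exact Or.inl (by rwa [min_eq_left h'] at h)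
    · exact Or.inr (by rwa [min_eq_right h'] at h)
  · rintro (h | h)
    · rw [h, min_eq_left (hat_zero_le _)]
    · rw [h, min_eq_right (hat_zero_le _)]

theorem val_iff (σ : ℕ → M.carrier) (φ ψ : Form L) :
    M.val σ (iff φ ψ) = dmax (M.val σ φ) (M.val σ ψ) := max_impVal_eq_dmax _ _

theorem val_imp_eq_zero (σ : ℕ → M.carrier) (φ ψ : Form L) :
    M.val σ (imp φ ψ) = hat 0 ↔ M.val σ ψ ≤ M.val σ φ := impVal_eq_zero_iff

theorem val_iff_eq_zero (σ : ℕ → M.carrier) (φ ψ : Form L) :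
    M.val σ (iff φ ψ) = hat 0 ↔ M.val σ φ = M.val σ ψ := by
  rw [val_iff]
  exact ⟨eq_of_dmax_eq_zero, fun h => if_pos h⟩

theorem val_alls_eq_zero (σ : ℕ → M.carrier) (k : ℕ) (φ : Form L) :
    M.val σ (alls k φ) = hat 0 ↔
      ∀ τ : ℕ → M.carrier, (∀ i, τ (i + k) = σ i) → M.val τ φ = hat 0 := by
  induction k generalizing σ with
  | zero =>
    constructor
    · intro h τ hτ
      rwa [show τ = σ from funext hτ]
    · intro h
      exact h σ fun _ => rfl
  | succ k ih =>
    simp only [alls, val, iSup_eq_hat_zero_iff, ih]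
    constructor
    · intro h τ hτ
      refine h (τ k) τ fun i => ?_
      cases i with
      | zero => simp [push]
      | succ i =>
        rw [show i + 1 + k = i + (k + 1) by omega]
        exact hτ i
    · intro h a τ hτ
      refine h τ fun i => ?_
      rw [show i + (k + 1) = i + 1 + k by omega]
      exact hτ (i + 1)

theorem val_conj_le (σ : ℕ → M.carrier) (l : List (Form L)) (z : TruthValue) :
    M.val σ (conj l) ≤ z ↔ ∀ φ ∈ l, M.val σ φ ≤ z := by
  induction l with
  | nil => simpa [conj, val] using hat_zero_le z
  | cons φ l ih =>
    cases l with
    | nil => simp [conj]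
    | cons ψ l =>
      simp only [conj, val, max_le_iff, ih]
      simp

theorem val_rglAx {φ : Form L} (h : RGLAx φ) (σ : ℕ → M.carrier) : M.val σ φ = hat 0 := by
  cases h with
  | g1 φ ψ χ =>
    rw [val_imp_eq_zero]
    simp only [val, impVal_le_iff]
    refine (le_max_impVal (M.val σ ψ) _).trans (max_le ?_ ?_)
    · refine (le_max_impVal (M.val σ φ) _).trans (max_le (le_max_left _ _) ?_)
      exact (le_max_right _ _).trans (le_max_right _ _)
    · exact (le_max_left _ _).trans (le_max_right _ _)
  | g2 φ ψ => exact (M.val_imp_eq_zero σ _ _).2 (le_max_left _ _)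
  | g3 φ ψ => exact (M.val_imp_eq_zero σ _ _).2 (max_comm _ _).le
  | g4 φ => exact (M.val_imp_eq_zero σ _ _).2 (max_self _).le
  | g5 φ ψ χ =>
    rw [val_iff_eq_zero]
    refine eq_of_forall_ge_iff fun z => ?_
    simp only [val, impVal_le_iff]
    rw [max_left_comm, max_assoc, max_left_comm]
  | g6 φ ψ χ =>
    rw [val_imp_eq_zero]
    simp only [val, impVal_le_iff]
    rcases le_total (M.val σ ψ) (M.val σ φ) with h | h
    · rw [impVal_eq_zero_iff.2 h, impVal_zero_left]
      exact le_max_right _ _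
    · rw [impVal_eq_zero_iff.2 h, impVal_zero_left]
      exact le_max_left _ _
  | g7 φ => exact (M.val_imp_eq_zero σ _ _).2 (le_hat_one _)
  | all1 φ t =>
    rw [val_imp_eq_zero, val_inst]
    exact le_iSup (fun a => M.val (M.push a σ) φ) _
  | all2 φ ψ =>
    rw [val_imp_eq_zero]
    simp only [val, impVal_le_iff, val_shift]
    refine iSup_le fun a => (le_max_impVal (M.val σ ψ) _).trans (max_le_max_left _ ?_)
    exact le_iSup (fun a => impVal (M.val σ ψ) (M.val (M.push a σ) φ)) a
  | all3 φ ψ =>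
    rw [val_imp_eq_zero, val_or]
    simp only [val, val_or, val_shift]
    have hle := le_iSup fun a => min (M.val σ ψ) (M.val (M.push a σ) φ)
    -- In a linear order either some instance reaches the value of `ψ`, where the minimum is that
    -- value, or all instances stay below it and the minimum is the instance itself.
    by_cases h : ∃ a, M.val σ ψ ≤ M.val (M.push a σ) φ
    · obtain ⟨a, ha⟩ := h
      refine (min_le_left _ _).trans (le_trans ?_ (hle a))
      exact le_min le_rfl ha
    · push Not at h
      refine (min_le_right _ _).trans (iSup_le fun a => le_trans ?_ (hle a))
      exact le_min (h a).le le_rfl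
  | ex1 φ t =>
    rw [val_imp_eq_zero, val_inst]
    exact iInf_le (fun a => M.val (M.push a σ) φ) _
  | ex2 φ ψ =>
    rw [val_imp_eq_zero]
    simp only [val, impVal_le_iff, val_shift]
    by_contra hlt
    rw [not_le, max_lt_iff] at hlt
    obtain ⟨a, ha⟩ := iInf_lt_iff.1 hlt.1
    have h1 := le_iSup (fun a => impVal (M.val (M.push a σ) φ) (M.val σ ψ)) a
    have h2 : impVal (M.val (M.push a σ) φ) (M.val σ ψ) = M.val σ ψ := if_neg (not_le.2 ha)
    simp only [h2] at h1
    exact absurd hlt.2 (not_lt.2 h1)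
  | rgl1 r s =>
    rw [val_iff_eq_zero]
    exact (hat_strictMono.monotone.map_max).symm
  | rgl2_ge r s h => exact (M.val_imp_eq_zero σ _ _).2 (hat_strictMono.monotone h)
  | rgl2_lt r s h =>
    rw [val_iff_eq_zero]
    exact if_neg (not_le.2 (hat_strictMono h))
  | rgl3 r h =>
    refine (M.val_imp_eq_zero σ _ _).2 (le_of_eq ?_)
    exact (if_neg (not_le.2 (hat_strictMono h))).symm

end Struct

end Semantics

/-! ### Soundness of ultrametric logic -/

section UltrametricSemantics

variable {L : UltrametricLanguage.{u, v}} (M : Struct.{u, v, w} L.toLanguage)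

/-- The conditions on an ultrametric structure, except that different elements may have
distance zero. -/
structure IsPseudoUltrametric : Prop where
  d_self : ∀ a, L.dVal M a a = hat 0
  d_comm : ∀ a b, L.dVal M a b = L.dVal M b a
  d_triangle : ∀ a b c, L.dVal M a b ≤ max (L.dVal M a c) (L.dVal M b c)
  fn_unif : ∀ {k : ℕ} (f : L.Functions k) (n : ℕ+) (a b : Fin k → M.carrier),
    L.dTuple M a b < hat (invConst (L.modFn f n)) →
      L.dVal M (M.fn f a) (M.fn f b) ≤ hat (invConst n)
  pred_unif : ∀ {k : ℕ} (P : L.Relations k) (n : ℕ+) (a b : Fin k → M.carrier),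
    L.dTuple M a b < hat (invConst (L.modPred P n)) →
      dmax (M.pred P a) (M.pred P b) ≤ hat (invConst n)

theorem UltrametricLanguage.IsUltrametric.isPseudoUltrametric
    {M : Struct.{u, v, w} L.toLanguage} (h : L.IsUltrametric M) : IsPseudoUltrametric M :=
  ⟨h.d_self, h.d_comm, h.d_triangle, h.fn_unif, h.pred_unif⟩

theorem val_dist (σ : ℕ → M.carrier) (s t : L.Term ℕ) :
    M.val σ (L.dist s t) = L.dVal M (M.termVal σ s) (M.termVal σ t) := by
  change M.pred L.d _ = M.pred L.d _
  congr 1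
  funext i
  fin_cases i <;> rfl

theorem val_distTuple (σ : ℕ → M.carrier) (k : ℕ) :
    M.val σ (L.distTuple k) = L.dTuple M (fun i : Fin k => σ i) fun i : Fin k => σ (k + i) := by
  refine eq_of_forall_ge_iff fun z => ?_
  rw [UltrametricLanguage.distTuple, Struct.val_conj_le, UltrametricLanguage.dTuple, iSup_le_iff]
  constructor
  · intro h i
    have := h _ ((List.mem_ofFn' _ _).2 ⟨i, rfl⟩)
    rwa [val_dist] at this
  · intro h φ hφ
    obtain ⟨i, rfl⟩ := (List.mem_ofFn' _ _).1 hφ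
    rw [val_dist]
    exact h i

theorem val_all_eq_zero (σ : ℕ → M.carrier) (φ : Form L.toLanguage) :
    M.val σ (all φ) = hat 0 ↔ ∀ a, M.val (M.push a σ) φ = hat 0 := iSup_eq_hat_zero_iff

/-- The assignment of two tuples to the first variables. -/
def assignTuples {M : Struct.{u, v, w} L.toLanguage} {k : ℕ} (a b : Fin k → M.carrier)
    (σ : ℕ → M.carrier) (i : ℕ) : M.carrier :=
  if h : i < k then a ⟨i, h⟩ else if h : i - k < k then b ⟨i - k, h⟩ else σ (i - (k + k))

theorem forall_assign_iff {k : ℕ} (σ : ℕ → M.carrier)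
    (p : (Fin k → M.carrier) → (Fin k → M.carrier) → Prop) :
    (∀ τ : ℕ → M.carrier, (∀ i, τ (i + (k + k)) = σ i) →
      p (fun i : Fin k => τ i) fun i : Fin k => τ (k + i)) ↔ ∀ a b, p a b := by
  constructor
  · intro h a b
    have h1 : (fun i : Fin k => assignTuples a b σ i) = a := by
      funext i
      simp [assignTuples]
    have h2 : (fun i : Fin k => assignTuples a b σ (k + i)) = b := by
      funext i
      simp [assignTuples]
    have := h (assignTuples a b σ) fun i => by
      have h3 : ¬ i + (k + k) < k := by omega
      have h4 : ¬ i + (k + k) - k < k := by omega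
      simp only [assignTuples, h3, h4, dif_neg, not_false_iff, Nat.add_sub_cancel]
    rwa [h1, h2] at this
  · exact fun h τ _ => h _ _

theorem val_weakExt_fn (σ : ℕ → M.carrier) {k : ℕ} (f : L.Functions k) (n : ℕ+) :
    M.val σ (alls (k + k) (or (imp (L.distTuple k) (const (invConst (L.modFn f n))))
        (imp (const (invConst n)) (L.dist (Term.func f (L.xs k)) (Term.func f (L.ys k)))))) =
      hat 0 ↔ ∀ a b : Fin k → M.carrier, L.dTuple M a b < hat (invConst (L.modFn f n)) →
        L.dVal M (M.fn f a) (M.fn f b) ≤ hat (invConst n) := by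
  rw [Struct.val_alls_eq_zero, ← forall_assign_iff M σ]
  refine forall₂_congr fun τ _ => ?_
  rw [Struct.val_or_eq_zero, Struct.val_imp_eq_zero, Struct.val_imp_eq_zero, val_distTuple,
    val_dist, ← not_lt, ← imp_iff_not_or]
  rfl

theorem val_weakExt_pred (σ : ℕ → M.carrier) {k : ℕ} (P : L.Relations k) (n : ℕ+) :
    M.val σ (alls (k + k) (or (imp (L.distTuple k) (const (invConst (L.modPred P n))))
        (imp (const (invConst n)) (iff (rel P (L.xs k)) (rel P (L.ys k)))))) =
      hat 0 ↔ ∀ a b : Fin k → M.carrier, L.dTuple M a b < hat (invConst (L.modPred P n)) →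
        dmax (M.pred P a) (M.pred P b) ≤ hat (invConst n) := by
  rw [Struct.val_alls_eq_zero, ← forall_assign_iff M σ]
  refine forall₂_congr fun τ _ => ?_
  rw [Struct.val_or_eq_zero, Struct.val_imp_eq_zero, Struct.val_imp_eq_zero, val_distTuple,
    Struct.val_iff, ← not_lt, ← imp_iff_not_or]
  rfl

/-- Each similarity or weak extensionality axiom evaluates to one of the conditions, and the other
axioms hold in every structure. One direction gives soundness, the other makes the term model a
pseudo-ultrametric structure. -/
theorem isPseudoUltrametric_iff : IsPseudoUltrametric M ↔
    ∀ φ, L.UMLAx φ → ∀ σ, M.val σ φ = hat 0 := by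
  constructor
  · intro h φ hφ σ
    cases hφ with
    | rgl h => exact M.val_rglAx h σ
    | s1 =>
      simp only [val_all_eq_zero, val_dist]
      exact fun a => h.d_self a
    | s2 =>
      simp only [val_all_eq_zero, Struct.val_imp_eq_zero, val_dist]
      exact fun a b => (h.d_comm b a).le
    | s3 =>
      simp only [val_all_eq_zero, Struct.val_imp_eq_zero]
      intro a b c
      simp only [Struct.val, val_dist]
      refine (h.d_triangle a c b).trans (max_le_max le_rfl (h.d_comm c b).le)
    | we1 f n => exact (val_weakExt_fn M σ f n).2 (h.fn_unif f n)
    | we2 P n => exact (val_weakExt_pred M σ P n).2 (h.pred_unif P n)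
  · intro h
    obtain ⟨m⟩ := M.nonempty
    have hcomm : ∀ a b, L.dVal M a b ≤ L.dVal M b a := by
      have := h _ .s2 fun _ => m
      simp only [val_all_eq_zero, Struct.val_imp_eq_zero, val_dist] at this
      exact fun a b => this b a
    have hself := h _ .s1 fun _ => m
    simp only [val_all_eq_zero, val_dist] at hself
    have htri := h _ .s3 fun _ => m
    simp only [val_all_eq_zero, Struct.val_imp_eq_zero] at htri
    refine ⟨fun a => hself a, fun a b => le_antisymm (hcomm a b) (hcomm b a), ?_, ?_, ?_⟩
    · intro a b c
      have := htri a c b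
      simp only [Struct.val, val_dist] at this
      exact this.trans (max_le_max le_rfl (hcomm c b))
    · exact fun f n => (val_weakExt_fn M (fun _ => m) f n).1 (h _ (.we1 f n) _)
    · exact fun P n => (val_weakExt_pred M (fun _ => m) P n).1 (h _ (.we2 P n) _)

variable {M}

theorem IsPseudoUltrametric.sound (hM : IsPseudoUltrametric M) {T : Theory L.toLanguage}
    (hT : M.Models T) {φ : Form L.toLanguage} (h : L.Provable T φ) (σ : ℕ → M.carrier) :
    M.val σ φ = hat 0 := by
  induction h generalizing σ with
  | ax h => exact (isPseudoUltrametric_iff M).1 hM _ h σ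
  | hyp φ h => exact hT φ h σ
  | mp _ _ h1 h2 => exact eq_hat_zero_of_le (h2 σ ▸ (M.val_imp_eq_zero σ _ _).1 (h1 σ))
  | gen _ h => exact (val_all_eq_zero M σ _).2 fun a => h _

theorem exists_finite_provable {T : Theory L.toLanguage} {φ : Form L.toLanguage}
    (h : L.Provable T φ) : ∃ S ⊆ T, S.Finite ∧ L.Provable S φ := by
  have mono : ∀ {S S' : Theory L.toLanguage} {φ}, S ⊆ S' → L.Provable S φ → L.Provable S' φ := by
    intro S S' φ hS h
    induction h with
    | ax h => exact .ax h
    | hyp φ h => exact .hyp φ (hS h)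
    | mp _ _ h1 h2 => exact .mp h1 h2
    | gen _ h => exact .gen h
  induction h with
  | ax h => exact ⟨∅, Set.empty_subset _, Set.finite_empty, .ax h⟩
  | hyp φ h => exact ⟨{φ}, Set.singleton_subset_iff.2 h, Set.finite_singleton φ, .hyp φ rfl⟩
  | mp _ _ h1 h2 =>
    obtain ⟨S, hS, fS, h1⟩ := h1
    obtain ⟨S', hS', fS', h2⟩ := h2
    exact ⟨S ∪ S', Set.union_subset hS hS', fS.union fS',
      .mp (mono Set.subset_union_left h1) (mono Set.subset_union_right h2)⟩
  | gen _ h =>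
    obtain ⟨S, hS, fS, h⟩ := h
    exact ⟨S, hS, fS, .gen h⟩

theorem stronglyConsistent_of_finitelySatisfiable {T : Theory L.toLanguage}
    (hT : UltrametricLanguage.FinitelySatisfiable.{u, v, w} L T) : L.StronglyConsistent T := by
  intro r hr h
  obtain ⟨S, hS, fS, h⟩ := exists_finite_provable h
  obtain ⟨M, hM, hMS⟩ := hT S hS fS
  obtain ⟨m⟩ := M.nonempty
  have := hM.isPseudoUltrametric.sound hMS h fun _ => m
  exact (hat_strictMono hr).ne' this

end UltrametricSemantics

/-! ### Identifying points at distance zero -/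

section SeparationQuotient

variable {L : UltrametricLanguage.{u, v}} {M : Struct.{u, v, w} L.toLanguage}

namespace IsPseudoUltrametric

variable (hM : IsPseudoUltrametric M)

include hM

theorem dVal_trans {a b c : M.carrier} (h1 : L.dVal M a b = hat 0) (h2 : L.dVal M b c = hat 0) :
    L.dVal M a c = hat 0 := by
  refine eq_hat_zero_of_le ((hM.d_triangle a c b).trans ?_)
  rw [h1, hM.d_comm c b, h2, max_self]

/-- Distance zero is below every `1 / δ_f(n)`, so the distance of the values is at most `1 / n` for
all `n`. -/
theorem fn_congr {k : ℕ} (f : L.Functions k) {a b : Fin k → M.carrier}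
    (h : ∀ i, L.dVal M (a i) (b i) = hat 0) : L.dVal M (M.fn f a) (M.fn f b) = hat 0 := by
  refine eq_hat_zero_of_forall_le fun n => hM.fn_unif f n a b ?_
  rw [UltrametricLanguage.dTuple, iSup_eq_hat_zero_iff.2 h]
  exact hat_strictMono (invConst_pos _)

theorem pred_congr {k : ℕ} (P : L.Relations k) {a b : Fin k → M.carrier}
    (h : ∀ i, L.dVal M (a i) (b i) = hat 0) : M.pred P a = M.pred P b := by
  refine eq_of_dmax_eq_zero (eq_hat_zero_of_forall_le fun n => hM.pred_unif P n a b ?_)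
  rw [UltrametricLanguage.dTuple, iSup_eq_hat_zero_iff.2 h]
  exact hat_strictMono (invConst_pos _)

end IsPseudoUltrametric

/-- The structure on a quotient of the carrier, defined by representatives. -/
noncomputable def imageStruct (M : Struct.{u, v, w} L.toLanguage) {C : Type w'}
    (π : M.carrier → C) (hπ : Function.Surjective π) : Struct.{u, v, w'} L.toLanguage where
  carrier := C
  nonempty := M.nonempty.map π
  fn f c := π (M.fn f fun i => Function.surjInv hπ (c i))
  pred P c := M.pred P fun i => Function.surjInv hπ (c i)

variable {C : Type w'} {π : M.carrier → C} (hπ : Function.Surjective π)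

theorem dVal_imageStruct (a b : C) : L.dVal (imageStruct M π hπ) a b =
    L.dVal M (Function.surjInv hπ a) (Function.surjInv hπ b) := by
  change M.pred L.d _ = M.pred L.d _
  congr 1
  funext i
  fin_cases i <;> rfl

variable (hM : IsPseudoUltrametric M) (hd : ∀ a b, π a = π b ↔ L.dVal M a b = hat 0)

include hM hd

theorem dVal_imageStruct_map (a b : M.carrier) :
    L.dVal (imageStruct M π hπ) (π a) (π b) = L.dVal M a b := by
  rw [dVal_imageStruct]
  refine hM.pred_congr L.d fun i => ?_
  fin_cases i
  · exact (hd _ _).1 (Function.surjInv_eq hπ _)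
  · exact (hd _ _).1 (Function.surjInv_eq hπ _)

theorem isUltrametric_imageStruct : L.IsUltrametric (imageStruct M π hπ) := by
  have hdv : ∀ a b : (imageStruct M π hπ).carrier, L.dVal (imageStruct M π hπ) a b =
      L.dVal M (Function.surjInv hπ a) (Function.surjInv hπ b) := dVal_imageStruct hπ
  have hdt : ∀ {k : ℕ} (a b : Fin k → (imageStruct M π hπ).carrier),
      L.dTuple (imageStruct M π hπ) a b = L.dTuple M (fun i => Function.surjInv hπ (a i))
        fun i => Function.surjInv hπ (b i) :=
    fun a b => iSup_congr fun i => hdv _ _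
  refine ⟨?_, ?_, ?_, ?_, ?_, ?_⟩
  · intro a
    rw [hdv]
    exact hM.d_self _
  · intro a b
    rw [hdv, hdv]
    exact hM.d_comm _ _
  · intro a b c
    rw [hdv, hdv, hdv]
    exact hM.d_triangle _ _ _
  · intro a b h
    rw [hdv] at h
    exact ((Function.surjInv_eq hπ a).symm.trans ((hd _ _).2 h)).trans (Function.surjInv_eq hπ b)
  · intro k f n a b h
    rw [hdt] at h
    exact (dVal_imageStruct_map hπ hM hd _ _).trans_le (hM.fn_unif f n _ _ h)
  · intro k P n a b h
    rw [hdt] at h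
    exact hM.pred_unif P n _ _ h

theorem termVal_imageStruct (σ : ℕ → M.carrier) (t : L.Term ℕ) :
    (imageStruct M π hπ).termVal (fun i => π (σ i)) t = π (M.termVal σ t) := by
  induction t with
  | var => rfl
  | func f ts ih =>
    refine (hd _ _).2 (hM.fn_congr f fun i => (hd _ _).1 ?_)
    exact (Function.surjInv_eq hπ _).trans (ih i)

theorem val_imageStruct (σ : ℕ → M.carrier) (φ : Form L.toLanguage) :
    (imageStruct M π hπ).val (fun i => π (σ i)) φ = M.val σ φ := by
  have hpush : ∀ (σ : ℕ → M.carrier) (a : M.carrier),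
      (imageStruct M π hπ).push (π a) (fun i => π (σ i)) = fun i => π (M.push a σ i) := by
    intro σ a
    funext i
    cases i <;> rfl
  induction φ generalizing σ with
  | const r => rfl
  | rel P ts =>
    refine hM.pred_congr P fun i => (hd _ _).1 ?_
    exact (Function.surjInv_eq hπ _).trans (termVal_imageStruct hπ hM hd σ (ts i))
  | and φ ψ h1 h2 => exact congrArg₂ max (h1 σ) (h2 σ)
  | imp φ ψ h1 h2 => exact congrArg₂ impVal (h1 σ) (h2 σ)
  | all φ ih =>
    refine (Function.Surjective.iSup_congr π hπ fun a => ?_).symm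
    rw [hpush]
    exact ih _
  | ex φ ih =>
    refine (Function.Surjective.iInf_congr π hπ fun a => ?_).symm
    rw [hpush]
    exact ih _

end SeparationQuotient

/-- A countable pseudo-ultrametric structure has an ultrametric quotient in every universe. -/
theorem IsPseudoUltrametric.satisfiable {L : UltrametricLanguage.{u, v}}
    {M : Struct.{u, v, w} L.toLanguage} (hM : IsPseudoUltrametric M) [Countable M.carrier]
    {T : Theory L.toLanguage} (hT : M.Models T) : UltrametricLanguage.Satisfiable.{u, v, w'} L T := by
  let s : Setoid M.carrier :=
    ⟨fun a b => L.dVal M a b = hat 0, hM.d_self, fun h => (hM.d_comm _ _).trans h,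
      fun h1 h2 => hM.dVal_trans h1 h2⟩
  -- Countability allows the quotient to be realized as a set of natural numbers, which lifts to any
  -- prescribed universe.
  obtain ⟨j, hj⟩ := exists_injective_nat (Quotient s)
  let g : M.carrier → ℕ := fun a => j (Quotient.mk s a)
  let π : M.carrier → ULift.{w'} (Set.range g) := fun a => ⟨⟨g a, a, rfl⟩⟩
  have hπ : Function.Surjective π := by
    rintro ⟨⟨_, a, rfl⟩⟩
    exact ⟨a, rfl⟩
  have hd : ∀ a b, π a = π b ↔ L.dVal M a b = hat 0 := by
    intro a b
    have h1 : π a = π b ↔ g a = g b :=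
      ⟨fun h => congrArg (fun x => x.down.1) h, fun h => ULift.ext _ _ (Subtype.ext h)⟩
    exact h1.trans (hj.eq_iff.trans Quotient.eq)
  refine ⟨imageStruct M π hπ, isUltrametric_imageStruct hπ hM hd, fun φ hφ σ => ?_⟩
  have hσ : σ = fun i => π (Function.surjInv hπ (σ i)) :=
    funext fun i => (Function.surjInv_eq hπ _).symm
  rw [hσ]
  exact (val_imageStruct hπ hM hd _ _).trans (hT φ hφ _)

theorem satisfiable_of_stronglyConsistent {L : UltrametricLanguage.{u, v}} [Countable L.Symbols]
    {T : Theory L.toLanguage} (hT : L.StronglyConsistent T) :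
    UltrametricLanguage.Satisfiable.{u, v, w} L T := by
  obtain ⟨M, hc, hM⟩ := exists_struct_of_stronglyConsistent hT
  exact ((isPseudoUltrametric_iff M).2 fun φ h => hM φ (.ax h)).satisfiable
    fun φ hφ => hM φ.1 (.hyp φ hφ)

end UltrametricLogic

theorem mainTheorem9 (L : UltrametricLogic.UltrametricLanguage.{u, v})
    (hL : Countable L.Symbols) (T : UltrametricLogic.Theory L.toLanguage) :
    (L.StronglyConsistent T → UltrametricLogic.UltrametricLanguage.Satisfiable.{u, v, w} L T) ∧
    (UltrametricLogic.UltrametricLanguage.FinitelySatisfiable.{u, v, w'} L T →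
      UltrametricLogic.UltrametricLanguage.Satisfiable.{u, v, w} L T) :=
  ⟨UltrametricLogic.satisfiable_of_stronglyConsistent, fun h =>
    UltrametricLogic.satisfiable_of_stronglyConsistent
      (UltrametricLogic.stronglyConsistent_of_finitelySatisfiable h)⟩
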